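/- **Notation.** Let $M,N\ge 1$ be integers and let $q,t,p\in\mathbf C$ with $0<|q|<1$, $|p|<1$, $t\neq 0$. Put $(x;q)_\infty=\prod_{n\ge0}(1-xq^n)$, $(x;q,p)_\infty=\prod_{m,n\ge0}(1-xq^mp^n)$, $\Theta_p(x)=(p;p)_\infty(x;p)_\infty(px^{-1};p)_\infty$ and $\Gamma_{q,p}(x)=(qpx^{-1};q,p)_\infty/(x;q,p)_\infty$. For functions of $x=(x_1,\dots,x_M)$ let $T_{q,x_i}$ replace $x_i$ by $qx_i$, and define the elliptic Macdonald operator $$H_M(q,t,p)_x=\sum_{i=1}^M\prod_{j\ne i}\frac{\Theta_p(tx_i/x_j)}{\Theta_p(x_i/x_j)}\,T_{q,x_i},$$ similarly $H_N(q,t,p)_y$ for $y=(y_1,\dots,y_N)$, and the elliptic kernel function $$\Pi_{MN}(q,t,p)(x,y)=\prod_{i=1}^M\prod_{j=1}^N\frac{\Gamma_{q,p}(x_iy_j)}{\Gamma_{q,p}(tx_iy_j)}.$$ Let $$C_{MN}(p;x,y)=\left[\prod_{i=1}^M\frac{\Theta_p(t^{-1}x_iz)}{\Theta_p(x_iz)}\prod_{j=1}^N\frac{\Theta_p(z/y_j)}{\Theta_p(t^{-1}z/y_j)}\right]_1$$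 be the constant term in $z$ of the Laurent expansion in the annulus $|p|<|x_iz|<1$, $|p|<|t^{-1}z/y_j|<1$ (all $i,j$). **Theorem (functional equation of the elliptic kernel function).** (1) Suppose $t\notin p^{\mathbf Z}$, the $x_i$ are nonzero and pairwise distinct, the $y_j$ are nonzero and pairwise distinct, $x_iy_jq^mp^n\ne1$ for all $i,j$ and all $m,n\ge0$, and the above annulus is nonempty. Then the Laurent expansion defining $C_{MN}$ exists and $$\{H_M(q,t,p)_x-t^{M-N}H_N(q,t,p)_y\}\Pi_{MN}(q,t,p)(x,y)=\frac{(1-t^{M-N})(p;p)_\infty^3}{\Theta_p(t)}\,C_{MN}(p;x,y)\,\Pi_{MN}(q,t,p)(x,y).$$ (2) Suppose $p\ne0$ and $t$ is not a root of unity. Let $a_n,b_n$ ($n\in\mathbf Z\setminus\{0\}$) be bosons with $[a_m,b_n]=0$, $[a_m,a_n]=m(1-p^{|m|})\frac{1-q^{|m|}}{1-t^{|m|}}\delta_{m+n,0}$, $[b_m,b_n]=m\frac{1-p^{|m|}}{(qt^{-1}p)^{|m|}}\frac{1-q^{|m|}}{1-t^{|m|}}\delta_{m+n,0}$, acting on the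 Fock space with vacuum $|0\rangle$ ($a_n|0\rangle=b_n|0\rangle=0$ for $n>0$) and dual vacuum $\langle0|$ ($\langle 0|a_n=\langle 0|b_n=0$ for $n<0$, $\langle 0|0\rangle=1$). Put $$(\eta(p;z))_\pm=\exp\Big(-\sum_{\pm n>0}\tfrac{1-t^{-n}}{1-p^{|n|}}p^{|n|}b_n\tfrac{z^n}{n}\Big)\exp\Big(-\sum_{\pm n>0}\tfrac{1-t^{n}}{1-p^{|n|}}a_n\tfrac{z^{-n}}{n}\Big),$$ $$\phi(p;z)=\exp\Big(\sum_{n>0}\tfrac{(1-t^n)(qt^{-1}p)^n}{(1-q^n)(1-p^n)}b_{-n}\tfrac{z^{-n}}n\Big)\exp\Big(\sum_{n>0}\tfrac{1-t^n}{(1-q^n)(1-p^n)}a_{-n}\tfrac{z^n}n\Big),$$ let $\phi^*(p;z)$ be the same expression with $a_n,b_n$ in place of $a_{-n},b_{-n}$, and put $\phi_N(p;y)=\prod_j\phi(p;y_j)$, $\phi^*_M(p;x)=\prod_i\phi^*(p;x_i)$. Suppose that for all $i,j$ $$|x_iy_j|<1,\quad |tx_iy_j|<1,\quad |qp|<|x_iy_j|,\quad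 |qp|<|tx_iy_j|,$$ and that for some $r>0$ and all $i,j$ $$\max(1,|t|^{-1})|x_i|r<1,\quad \max(1,|t|)|p|<|x_i|r,\quad \max(1,|t|)|py_j|<r,\quad r<\min(1,|t|)|y_j|.$$ Then the expansion of the following matrix element in monomials in the bosons converges absolutely, $\Pi_{MN}(q,t,p)(x,y)\neq0$, and $$C_{MN}(p;x,y)=\frac{\langle0|\phi^*_M(p;x)\,[(\eta(p;z))_-(\eta(p;p^{-1}z))_+]_1\,\phi_N(p;y)|0\rangle}{\Pi_{MN}(q,t,p)(x,y)}.$$ (3) Suppose $t\ne1$, the $x_i$ are nonzero and pairwise distinct, the $y_j$ are nonzero and pairwise distinct, and $x_iy_jq^m\neq1$ for all $i,j$ and $m\ge0$. As $p\to0$ ($p\neq 0$), $C_{MN}(p;x,y)\to1$, and the left and right sides of the equation in (1) converge to the left and right sides, respectively, of the Komori–Noumi–Shiraishi identity $$\{H_M(q,t)_x-t^{M-N}H_N(q,t)_y\}\Pi_{MN}(q,t)(x,y)=\frac{1-t^{M-N}}{1-t}\Pi_{MN}(q,t)(x,y),$$ which therefore holds; here $H_M(q,t)_x=\sum_{i}\prod_{j\neq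 i}\frac{tx_i-x_j}{x_i-x_j}T_{q,x_i}$ and $\Pi_{MN}(q,t)(x,y)=\prod_{i,j}\frac{(tx_iy_j;q)_\infty}{(x_iy_j;q)_\infty}$. -/

import Mathlib

open scoped Topology LaurentPolynomial

namespace EllipticKernel

noncomputable section

/-! ### Infinite products, theta function, elliptic gamma function -/

/-- `(x; q)_∞ = ∏_{n ≥ 0} (1 - x qⁿ)`. -/
def qPoch (q x : ℂ) : ℂ := ∏' n : ℕ, (1 - x * q ^ n)

/-- `(x; q, p)_∞ = ∏_{m, n ≥ 0} (1 - x qᵐ pⁿ)`. -/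
def qpPoch (q p x : ℂ) : ℂ := ∏' k : ℕ × ℕ, (1 - x * q ^ k.1 * p ^ k.2)

/-- `Θ_p(x) = (p; p)_∞ (x; p)_∞ (p x⁻¹; p)_∞`. -/
def theta (p x : ℂ) : ℂ := qPoch p p * qPoch p x * qPoch p (p * x⁻¹)

/-- `Γ_{q,p}(x) = (q p x⁻¹; q, p)_∞ / (x; q, p)_∞`. -/
def ellGamma (q p x : ℂ) : ℂ := qpPoch q p (q * p * x⁻¹) / qpPoch q p x

/-! ### Macdonald operators and kernel functions -/

/-- The `q`-shift `T_{q,x_i}`: it replaces the `i`-th variable `x_i` by `q x_i`. -/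
def qShift {M : ℕ} (q : ℂ) (i : Fin M) (f : (Fin M → ℂ) → ℂ) (x : Fin M → ℂ) : ℂ :=
  f (Function.update x i (q * x i))

/-- The elliptic Macdonald operator `H_M(q,t,p)`. -/
def ellMacdonald (M : ℕ) (q t p : ℂ) (f : (Fin M → ℂ) → ℂ) (x : Fin M → ℂ) : ℂ :=
  ∑ i, (∏ j ∈ Finset.univ.erase i, theta p (t * x i / x j) / theta p (x i / x j)) * qShift q i f x

/-- The elliptic kernel function `Π_{MN}(q,t,p)(x,y)`. -/
def ellKernel (M N : ℕ) (q t p : ℂ) (x : Fin M → ℂ) (y : Fin N → ℂ) : ℂ :=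
  ∏ i, ∏ j, ellGamma q p (x i * y j) / ellGamma q p (t * x i * y j)

/-- The (trigonometric) Macdonald operator `H_M(q,t)`. -/
def trigMacdonald (M : ℕ) (q t : ℂ) (f : (Fin M → ℂ) → ℂ) (x : Fin M → ℂ) : ℂ :=
  ∑ i, (∏ j ∈ Finset.univ.erase i, (t * x i - x j) / (x i - x j)) * qShift q i f x

/-- The (trigonometric) kernel function `Π_{MN}(q,t)(x,y)`. -/
def trigKernel (M N : ℕ) (q t : ℂ) (x : Fin M → ℂ) (y : Fin N → ℂ) : ℂ :=
  ∏ i, ∏ j, qPoch q (t * x i * y j) / qPoch q (x i * y j)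

/-! ### Constant terms of Laurent expansions -/

/-- `∑_{n ∈ ℤ} a_n zⁿ` converges (absolutely) to `f z` for all `z ∈ A`. -/
def HasLaurentExpansionOn (f : ℂ → ℂ) (A : Set ℂ) (a : ℤ → ℂ) : Prop :=
  ∀ z ∈ A, HasSum (fun n : ℤ => a n * z ^ n) (f z)

open Classical in
/-- The constant term `[f(z)]_1` of the Laurent expansion of `f` on `A`. It is used only for
nonempty open annuli `A` centred at `0`, where the expansion is unique. -/
def constantTerm (f : ℂ → ℂ) (A : Set ℂ) : ℂ :=
  if h : ∃ a, HasLaurentExpansionOn f A a then h.choose 0 else 0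

/-- The ratio of theta functions whose constant term in `z` is `C_{MN}(p;x,y)`. -/
def thetaRatio (M N : ℕ) (t p : ℂ) (x : Fin M → ℂ) (y : Fin N → ℂ) (z : ℂ) : ℂ :=
  (∏ i, theta p (t⁻¹ * x i * z) / theta p (x i * z)) *
    ∏ j, theta p (z / y j) / theta p (t⁻¹ * z / y j)

/-- The annulus on which `thetaRatio` is expanded: `|p| < |x_i z| < 1` and
`|p| < |t⁻¹ z / y_j| < 1` for all `i`, `j`. -/
def expansionDomain (M N : ℕ) (t p : ℂ) (x : Fin M → ℂ) (y : Fin N → ℂ) : Set ℂ :=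
  {z | (∀ i, ‖p‖ < ‖x i * z‖ ∧ ‖x i * z‖ < 1) ∧
    ∀ j, ‖p‖ < ‖t⁻¹ * z / y j‖ ∧ ‖t⁻¹ * z / y j‖ < 1}

/-- `C_{MN}(p;x,y)`. -/
def ellC (M N : ℕ) (t p : ℂ) (x : Fin M → ℂ) (y : Fin N → ℂ) : ℂ :=
  constantTerm (thetaRatio M N t p x y) (expansionDomain M N t p x y)

/-! ### Boson Fock space and the vacuum expectation value -/

/-- The boson modes: `Sum.inl n` stands for `a_{±n}` and `Sum.inr n` for `b_{±n}`, `n ≥ 1`. -/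
abbrev Mode : Type := ℕ+ ⊕ ℕ+

/-- The Fock space spanned by the vectors `a_{-λ} b_{-μ} |0⟩`, identified with the polynomials in
the creation operators `a_{-n}`, `b_{-n}`; the vacuum `|0⟩` is the polynomial `1`. -/
abbrev Fock : Type := MvPolynomial Mode ℂ

/-- The commutators `[a_n, a_{-n}]` and `[b_n, b_{-n}]` for `n ≥ 1`. -/
def bosonNorm (q t p : ℂ) : Mode → ℂ
  | Sum.inl n => (n : ℂ) * (1 - p ^ (n : ℕ)) * ((1 - q ^ (n : ℕ)) / (1 - t ^ (n : ℕ)))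
  | Sum.inr n => (n : ℂ) * ((1 - p ^ (n : ℕ)) / (q * t⁻¹ * p) ^ (n : ℕ)) *
      ((1 - q ^ (n : ℕ)) / (1 - t ^ (n : ℕ)))

/-- The creation operators `a_{-n}`, `b_{-n}` on the Fock space. -/
def creation (m : Mode) : Module.End ℂ Fock := LinearMap.mulLeft ℂ (MvPolynomial.X m)

/-- The annihilation operators `a_n`, `b_n` on the Fock space: they kill the vacuum and satisfy
the boson commutation relations with the creation operators. -/
def annihilation (q t p : ℂ) (m : Mode) : Module.End ℂ Fock :=
  bosonNorm q t p m • ((MvPolynomial.pderiv m : Derivation ℂ Fock Fock) : Fock →ₗ[ℂ] Fock)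

theorem creation_commute (m n : Mode) : Commute (creation m) (creation n) := by
  apply LinearMap.ext
  intro f
  simp [creation, mul_left_comm]

theorem annihilation_commute (q t p : ℂ) (m n : Mode) :
    Commute (annihilation q t p m) (annihilation q t p n) := by
  have h : ⁅(MvPolynomial.pderiv m : Derivation ℂ Fock Fock), (MvPolynomial.pderiv n : Derivation ℂ Fock Fock)⁆ = 0 := by
    apply MvPolynomial.derivation_ext
    intro i
    classical
    simp [Derivation.commutator_apply, MvPolynomial.pderiv_X, Pi.single_apply, apply_ite]
  apply Commute.smul_left
  apply Commute.smul_right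
  apply LinearMap.ext
  intro f
  have := congrArg (fun D : Derivation ℂ Fock Fock => D f) h
  simpa [Derivation.commutator_apply, sub_eq_zero] using this

theorem annihilation_vacuum (q t p : ℂ) (m : Mode) : annihilation q t p m 1 = 0 := by
  simp [annihilation]

theorem annihilation_creation_comm (q t p : ℂ) (m n : Mode) :
    annihilation q t p m * creation n - creation n * annihilation q t p m =
      if m = n then bosonNorm q t p m • (1 : Module.End ℂ Fock) else 0 := by
  classical
  apply LinearMap.ext
  intro f
  by_cases h : m = n
  · subst h
    simp [annihilation, creation, mul_comm, smul_add]
  · have h' : n ≠ m := fun e => h e.symm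
    simp [annihilation, creation, h, MvPolynomial.pderiv_X_of_ne h']

/-- The product `∏_m a_{-m}^{k_m}` of creation operators. -/
def creationMonomial (k : Mode →₀ ℕ) : Module.End ℂ Fock :=
  k.support.noncommProd (fun m => creation m ^ k m)
    (fun m _ n _ _ => (creation_commute m n).pow_pow _ _)

/-- The product `∏_m a_m^{k_m}` of annihilation operators. -/
def annihilationMonomial (q t p : ℂ) (k : Mode →₀ ℕ) : Module.End ℂ Fock :=
  k.support.noncommProd (fun m => annihilation q t p m ^ k m)
    (fun m _ n _ _ => (annihilation_commute q t p m n).pow_pow _ _)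

/-- The vacuum expectation value `⟨0| A |0⟩`: the coefficient of `|0⟩` in `A |0⟩`. -/
def vev (A : Module.End ℂ Fock) : ℂ := MvPolynomial.constantCoeff (A 1)

/-- The expansion of `exp (∑_m d_m u_m)` in monomials in commuting symbols `u_m`. -/
def expSeries {R : Type*} [CommRing R] [Algebra ℂ R] (d : Mode → R) : MvPowerSeries Mode R :=
  fun k => k.prod fun m e => ((e.factorial : ℂ)⁻¹) • d m ^ e

/-- The coefficients in the exponents of `φ(p;z)` (of `a_{-n}` and `b_{-n}`) and of `φ^*(p;z)`
(of `a_n` and `b_n`). -/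
def phiCoeff (q t p z : ℂ) : Mode → ℂ
  | Sum.inl n => (1 - t ^ (n : ℕ)) / ((1 - q ^ (n : ℕ)) * (1 - p ^ (n : ℕ))) *
      (z ^ (n : ℕ) / (n : ℂ))
  | Sum.inr n => (1 - t ^ (n : ℕ)) * (q * t⁻¹ * p) ^ (n : ℕ) /
      ((1 - q ^ (n : ℕ)) * (1 - p ^ (n : ℕ))) * ((z ^ (n : ℕ))⁻¹ / (n : ℂ))

/-- The coefficient of `a_n` (`n ≠ 0`) in the exponent of `η(p; c z)`, with `z` the Laurent
variable: `-(1 - tⁿ) / (1 - p^|n|) * (c z)⁻ⁿ / n`. -/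
def etaCoeffA (t p c : ℂ) (n : ℤ) : ℂ[T;T⁻¹] :=
  LaurentPolynomial.C (-((1 - t ^ n) / (1 - p ^ n.natAbs)) * (c ^ (-n) / (n : ℂ))) *
    LaurentPolynomial.T (-n)

/-- The coefficient of `b_n` (`n ≠ 0`) in the exponent of `η(p; c z)`, with `z` the Laurent
variable: `-(1 - t⁻ⁿ) / (1 - p^|n|) * p^|n| * (c z)ⁿ / n`. -/
def etaCoeffB (t p c : ℂ) (n : ℤ) : ℂ[T;T⁻¹] :=
  LaurentPolynomial.C (-((1 - t ^ (-n)) / (1 - p ^ n.natAbs) * p ^ n.natAbs) *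
    (c ^ n / (n : ℂ))) * LaurentPolynomial.T n

/-- The coefficients of `a_{-n}`, `b_{-n}`, `n ≥ 1`, in the exponent of `(η(p; c z))_-`. -/
def etaMinusCoeff (t p c : ℂ) : Mode → ℂ[T;T⁻¹]
  | Sum.inl n => etaCoeffA t p c (-(n : ℤ))
  | Sum.inr n => etaCoeffB t p c (-(n : ℤ))

/-- The coefficients of `a_n`, `b_n`, `n ≥ 1`, in the exponent of `(η(p; c z))_+`. -/
def etaPlusCoeff (t p c : ℂ) : Mode → ℂ[T;T⁻¹]
  | Sum.inl n => etaCoeffA t p c (n : ℤ)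
  | Sum.inr n => etaCoeffB t p c (n : ℤ)

/-- The term of
`⟨0| φ^*_M(p;x) [(η(p;z))_- (η(p;p⁻¹z))_+]_1 φ_N(p;y) |0⟩`
obtained by taking from the four factors (in this order) the monomials with exponents
`k.1`, `k.2.1`, `k.2.2.1`, `k.2.2.2` in the annihilation, creation, annihilation and creation
operators, respectively. -/
def matrixElementTerm (M N : ℕ) (q t p : ℂ) (x : Fin M → ℂ) (y : Fin N → ℂ)
    (k : (Mode →₀ ℕ) × (Mode →₀ ℕ) × (Mode →₀ ℕ) × (Mode →₀ ℕ)) : ℂ :=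
  MvPowerSeries.coeff k.1 (∏ i, expSeries (phiCoeff q t p (x i))) *
  (MvPowerSeries.coeff k.2.1 (expSeries (etaMinusCoeff t p 1)) *
    MvPowerSeries.coeff k.2.2.1 (expSeries (etaPlusCoeff t p p⁻¹))).coeff 0 *
  MvPowerSeries.coeff k.2.2.2 (∏ j, expSeries (phiCoeff q t p (y j))) *
  vev (annihilationMonomial q t p k.1 * creationMonomial k.2.1 *
    annihilationMonomial q t p k.2.2.1 * creationMonomial k.2.2.2)

/-- `⟨0| φ^*_M(p;x) [(η(p;z))_- (η(p;p⁻¹z))_+]_1 φ_N(p;y) |0⟩`. -/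
def matrixElement (M N : ℕ) (q t p : ℂ) (x : Fin M → ℂ) (y : Fin N → ℂ) : ℂ :=
  ∑' k, matrixElementTerm M N q t p x y k

/-- The region in which the free field series converges absolutely: there is a radius `r = |z|`
for which all power series in `x_i y_j`, `q p t⁻¹ / (x_i y_j)`, `x_i z`, `p / (x_i z)`,
`p y_j / z`, `z / y_j` that occur as exponents in commuting two of the four factors converge. -/
def FreeFieldRegion (M N : ℕ) (q t p : ℂ) (x : Fin M → ℂ) (y : Fin N → ℂ) : Prop :=
  (∀ i j, ‖x i * y j‖ < 1 ∧ ‖t * x i * y j‖ < 1 ∧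
    ‖q * p‖ < ‖x i * y j‖ ∧ ‖q * p‖ < ‖t * x i * y j‖) ∧
  ∃ r : ℝ, 0 < r ∧
    (∀ i, ‖x i‖ * r < 1 ∧ ‖t⁻¹ * x i‖ * r < 1 ∧ ‖p‖ < ‖x i‖ * r ∧ ‖t * p‖ < ‖x i‖ * r) ∧
    ∀ j, ‖p * y j‖ < r ∧ ‖t * p * y j‖ < r ∧ r < ‖y j‖ ∧ r < ‖t * y j‖

end

end EllipticKernel

open EllipticKernel Filter

/-!
On a circle `|z| = r` in the expansion domain, `C_{MN}` is the average of the theta ratio `F`.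
Each theta function changes by a monomial under `z ↦ p z`, and altogether
`F(p z) = t ^ (M - N) F(z)`. Hence `(1 - t ^ (N - M)) C_{MN}` is minus the sum of the residues of
`F(z) / z` between the circles of radii `r` and `r / |p|`. There is one simple pole for each `x_i`
and each `y_j`, and its residue is a multiple of the corresponding summand of `H_M Π_{MN}` or
`H_N Π_{MN}`, divided by `Π_{MN}`. This proves the functional equation for `p ≠ 0` and parameters
for which the poles are distinct; the other cases, in particular `p = 0`, follow by continuity, as
do the limits `p → 0`.

In the Fock space, the matrix element is a sum over the exponents of the contractions. Together
with the extraction of the constant term this is a product of exponential series in the pairings of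
the four vertex operators, which are the Laurent series of logarithms of `Θ_p` and `Γ_{q,p}`.
-/

namespace EllipticKernel

section InfiniteProducts

variable {q p x : ℂ}

lemma summable_norm_mul_pow_mul_pow (hq : ‖q‖ < 1) (hp : ‖p‖ < 1) (x : ℂ) :
    Summable fun k : ℕ × ℕ => ‖x * q ^ k.1 * p ^ k.2‖ := by
  have hgeom := ((summable_geometric_of_lt_one (norm_nonneg q) hq).mul_of_nonneg
    (summable_geometric_of_lt_one (norm_nonneg p) hp)
    (fun n => by positivity) (fun n => by positivity)).mul_left ‖x‖
  exact hgeom.congr fun k => by simp only [norm_mul, norm_pow, mul_assoc]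

lemma norm_mul_pow_mul_pow_le (hq : ‖q‖ < 1) (hp : ‖p‖ < 1) (m n : ℕ) :
    ‖x * q ^ m * p ^ n‖ ≤ ‖x‖ := by
  have hqm := pow_le_one₀ (n := m) (norm_nonneg q) hq.le
  have hpn := pow_le_one₀ (n := n) (norm_nonneg p) hp.le
  calc ‖x * q ^ m * p ^ n‖ = ‖x‖ * ‖q‖ ^ m * ‖p‖ ^ n := by simp only [norm_mul, norm_pow]
    _ ≤ ‖x‖ * 1 * 1 := by gcongr
    _ = ‖x‖ := by ring

lemma multipliable_qpPoch (hq : ‖q‖ < 1) (hp : ‖p‖ < 1) (x : ℂ) :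
    Multipliable fun k : ℕ × ℕ => 1 - x * q ^ k.1 * p ^ k.2 := by
  simp only [sub_eq_add_neg]
  refine multipliable_one_add_of_summable ?_
  simpa only [norm_neg] using summable_norm_mul_pow_mul_pow hq hp x

lemma qpPoch_ne_zero (hq : ‖q‖ < 1) (hp : ‖p‖ < 1) (h : ∀ m n : ℕ, x * q ^ m * p ^ n ≠ 1) :
    qpPoch q p x ≠ 0 := by
  simp only [qpPoch, sub_eq_add_neg]
  refine tprod_one_add_ne_zero_of_summable (fun k => ?_) ?_
  · rw [← sub_eq_add_neg]
    exact sub_ne_zero.mpr (h k.1 k.2).symm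
  · simpa only [norm_neg] using summable_norm_mul_pow_mul_pow hq hp x

lemma qpPoch_ne_zero_of_norm_lt_one (hq : ‖q‖ < 1) (hp : ‖p‖ < 1) (hx : ‖x‖ < 1) :
    qpPoch q p x ≠ 0 := by
  refine qpPoch_ne_zero hq hp fun m n h => ?_
  have hle := norm_mul_pow_mul_pow_le (x := x) hq hp m n
  rw [h, norm_one] at hle
  exact hle.not_gt hx

lemma qPoch_eq_qpPoch_zero (p x : ℂ) : qPoch p x = qpPoch 0 p x := by
  have hinj : Function.Injective fun n : ℕ => ((0, n) : ℕ × ℕ) := fun a b h => by simpa using h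
  have hsupp : Function.mulSupport (fun k : ℕ × ℕ => 1 - x * 0 ^ k.1 * p ^ k.2) ⊆
      Set.range fun n : ℕ => ((0, n) : ℕ × ℕ) := by
    rintro ⟨m, n⟩ h
    rcases m with _ | m
    · exact ⟨n, rfl⟩
    · simp at h
  simpa [qPoch, qpPoch] using hinj.tprod_eq hsupp

lemma qpPoch_comm (q p x : ℂ) : qpPoch q p x = qpPoch p q x := by
  unfold qpPoch
  rw [← (Equiv.prodComm ℕ ℕ).tprod_eq]
  exact tprod_congr fun k => by simp only [Equiv.prodComm_apply, Prod.fst_swap, Prod.snd_swap]; ring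

lemma qpPoch_zero_right (q x : ℂ) : qpPoch q 0 x = qPoch q x := by
  rw [qpPoch_comm, qPoch_eq_qpPoch_zero]

lemma qPoch_ne_zero (hp : ‖p‖ < 1) (h : ∀ n : ℕ, x * p ^ n ≠ 1) : qPoch p x ≠ 0 := by
  rw [qPoch_eq_qpPoch_zero]
  refine qpPoch_ne_zero (by simp) hp fun m n => ?_
  rcases m with _ | m
  · simpa using h n
  · simp

lemma qPoch_ne_zero_of_norm_lt_one (hp : ‖p‖ < 1) (hx : ‖x‖ < 1) : qPoch p x ≠ 0 :=
  qPoch_eq_qpPoch_zero p x ▸ qpPoch_ne_zero_of_norm_lt_one (by simp) hp hx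

lemma qPoch_self_ne_zero (hp : ‖p‖ < 1) : qPoch p p ≠ 0 := qPoch_ne_zero_of_norm_lt_one hp hp

lemma multipliable_qPoch (hp : ‖p‖ < 1) (x : ℂ) : Multipliable fun n : ℕ => 1 - x * p ^ n := by
  simp only [sub_eq_add_neg]
  refine multipliable_one_add_of_summable ?_
  simpa using (summable_geometric_of_lt_one (norm_nonneg p) hp).mul_left ‖x‖

lemma qPoch_eq_one_sub_mul (hp : ‖p‖ < 1) (x : ℂ) : qPoch p x = (1 - x) * qPoch p (p * x) := by
  have hshift (n : ℕ) : 1 - p * x * p ^ n = 1 - x * p ^ (n + 1) := by ring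
  have htail := (multipliable_qPoch hp (p * x)).congr fun n => hshift n
  unfold qPoch
  rw [← htail.prod_mul_tprod_nat_mul' (f := fun n : ℕ => 1 - x * p ^ n) (k := 1)]
  simp only [Finset.prod_range_one, pow_zero, mul_one, hshift]

lemma qPoch_zero_left (x : ℂ) : qPoch 0 x = 1 - x := by
  rw [qPoch_eq_one_sub_mul (by simp), zero_mul, qPoch]
  simp

lemma hasProd_qPoch_mul_pow (hq : ‖q‖ < 1) (hp : ‖p‖ < 1) (x : ℂ) :
    HasProd (fun m : ℕ => qPoch p (x * q ^ m)) (qpPoch q p x) :=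
  (multipliable_qpPoch hq hp x).hasProd.prod_fiberwise fun m =>
    (multipliable_qPoch hp (x * q ^ m)).hasProd

lemma qpPoch_eq_qPoch_mul (hq : ‖q‖ < 1) (hp : ‖p‖ < 1) (x : ℂ) :
    qpPoch q p x = qPoch p x * qpPoch q p (q * x) := by
  have htail : HasProd (fun m : ℕ => qPoch p (x * q ^ (m + 1))) (qpPoch q p (q * x)) := by
    convert! hasProd_qPoch_mul_pow hq hp (q * x) using 3 with m
    ring
  rw [← (hasProd_qPoch_mul_pow hq hp x).tprod_eq,
    ← htail.multipliable.prod_mul_tprod_nat_mul' (k := 1)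
      (f := fun m : ℕ => qPoch p (x * q ^ m)), htail.tprod_eq]
  simp

lemma differentiable_qPoch (hp : ‖p‖ < 1) : Differentiable ℂ (qPoch p) := by
  have hball (R : ℝ) : DifferentiableOn ℂ (qPoch p) (Metric.ball 0 R) := by
    have hprod := (((summable_geometric_of_lt_one (norm_nonneg p) hp).mul_left
      R)).hasProdLocallyUniformlyOn_nat_one_add
      (f := fun n (x : ℂ) => -(x * p ^ n)) (K := Metric.ball (0 : ℂ) R) Metric.isOpen_ball
      (.of_forall fun n x hx => by
        have : ‖x‖ ≤ R := (mem_ball_zero_iff.mp hx).le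
        rw [norm_neg, norm_mul, norm_pow]
        gcongr) (fun n => by fun_prop)
    have hdiff := hprod.differentiableOn (.of_forall fun s => by
      simpa [Finset.prod_fn] using DifferentiableOn.finsetProd (fun _ _ => by fun_prop))
      Metric.isOpen_ball
    simpa only [← sub_eq_add_neg] using! hdiff
  exact fun x => (hball (‖x‖ + 1)).differentiableAt (Metric.isOpen_ball.mem_nhds (by simp))

variable {ι : Type*} {l : Filter ι} {pl xl : ι → ℂ}

lemma tendsto_qpPoch (hq : ‖q‖ < 1) (hp : ‖p‖ < 1) (hpl : Tendsto pl l (𝓝 p))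
    (hxl : Tendsto xl l (𝓝 x)) :
    Tendsto (fun s => qpPoch q (pl s) (xl s)) l (𝓝 (qpPoch q p x)) := by
  obtain ⟨ρ, hρ, hρ1⟩ := exists_between hp
  have hρ0 : 0 ≤ ρ := (norm_nonneg _).trans hρ.le
  have hbound := ((summable_geometric_of_lt_one (norm_nonneg q) hq).mul_of_nonneg
    (summable_geometric_of_lt_one hρ0 hρ1)
    (fun n => by positivity) (fun n => by positivity)).mul_left (‖x‖ + 1)
  simp only [qpPoch, sub_eq_add_neg]
  refine tendsto_tprod_one_add_of_dominated_convergence hbound (fun k => ?_) ?_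
  · exact ((hxl.mul_const _).mul (hpl.pow _)).neg
  · filter_upwards [hpl.norm.eventually (gt_mem_nhds hρ),
      hxl.norm.eventually (gt_mem_nhds (lt_add_one ‖x‖))] with s hps hxs k
    rw [norm_neg, norm_mul, norm_mul, norm_pow, norm_pow, mul_assoc]
    gcongr

lemma tendsto_qPoch (hp : ‖p‖ < 1) (hpl : Tendsto pl l (𝓝 p)) (hxl : Tendsto xl l (𝓝 x)) :
    Tendsto (fun s => qPoch (pl s) (xl s)) l (𝓝 (qPoch p x)) := by
  simp only [qPoch_eq_qpPoch_zero]
  exact tendsto_qpPoch (by simp) hp hpl hxl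

end InfiniteProducts

section Theta

variable {p x : ℂ}

lemma theta_eq_one_sub_mul (hp : ‖p‖ < 1) (x : ℂ) :
    theta p x = (1 - x) * (qPoch p p * qPoch p (p * x) * qPoch p (p * x⁻¹)) := by
  rw [theta, qPoch_eq_one_sub_mul hp x]
  ring

lemma theta_zero_left (x : ℂ) : theta 0 x = 1 - x := by
  simp [theta, qPoch_zero_left]

lemma theta_inv (hp : ‖p‖ < 1) (hx : x ≠ 0) : theta p x⁻¹ = -x⁻¹ * theta p x := by
  rw [theta_eq_one_sub_mul hp, theta_eq_one_sub_mul hp, inv_inv]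
  field_simp
  ring

lemma theta_mul_left (hp : ‖p‖ < 1) (hp0 : p ≠ 0) (hx : x ≠ 0) :
    theta p (p * x) = -x⁻¹ * theta p x := by
  have hinv : p * (p * x)⁻¹ = x⁻¹ := by field_simp
  rw [theta, theta, hinv, qPoch_eq_one_sub_mul hp x⁻¹, qPoch_eq_one_sub_mul hp x]
  field_simp
  ring

lemma theta_ne_zero (hp : ‖p‖ < 1) (hx : x ≠ 0) (h : ∀ k : ℤ, x ≠ p ^ k) : theta p x ≠ 0 := by
  refine mul_ne_zero (mul_ne_zero (qPoch_self_ne_zero hp) (qPoch_ne_zero hp fun n hn => ?_))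
    (qPoch_ne_zero hp fun n hn => ?_)
  · apply h (-(n : ℤ))
    rw [zpow_neg, zpow_natCast]
    exact eq_inv_of_mul_eq_one_left hn
  · apply h ((n + 1 : ℕ) : ℤ)
    rw [zpow_natCast, pow_succ']
    field_simp at hn
    exact hn.symm

lemma norm_mul_inv_lt_one {a b : ℂ} (h : ‖a‖ < ‖b‖) : ‖a * b⁻¹‖ < 1 := by
  rw [norm_mul, norm_inv, ← div_eq_mul_inv]
  exact (div_lt_one ((norm_nonneg a).trans_lt h)).mpr h

lemma theta_ne_zero_of_norm (hpx : ‖p‖ < ‖x‖) (hx : ‖x‖ < 1) : theta p x ≠ 0 := by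
  have hp := hpx.trans hx
  exact mul_ne_zero (mul_ne_zero (qPoch_self_ne_zero hp) (qPoch_ne_zero_of_norm_lt_one hp hx))
    (qPoch_ne_zero_of_norm_lt_one hp (norm_mul_inv_lt_one hpx))

lemma tendsto_theta {ι : Type*} {l : Filter ι} {pl xl : ι → ℂ} (hp : ‖p‖ < 1) (hx : x ≠ 0)
    (hpl : Tendsto pl l (𝓝 p)) (hxl : Tendsto xl l (𝓝 x)) :
    Tendsto (fun s => theta (pl s) (xl s)) l (𝓝 (theta p x)) :=
  ((tendsto_qPoch hp hpl hpl).mul (tendsto_qPoch hp hpl hxl)).mul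
    (tendsto_qPoch hp hpl (hpl.mul (hxl.inv₀ hx)))

end Theta

section EllipticGamma

variable {q p x : ℂ}

lemma ellGamma_zero_middle (q x : ℂ) : ellGamma q 0 x = (qPoch q x)⁻¹ := by
  rw [ellGamma, qpPoch_zero_right, qpPoch_zero_right]
  simp [qPoch]

lemma qpPoch_mul_inv_mul_left (hq0 : q ≠ 0) (hq : ‖q‖ < 1) (hp : ‖p‖ < 1) (x : ℂ) :
    qpPoch q p (q * p * (q * x)⁻¹) = qPoch p (p * x⁻¹) * qpPoch q p (q * p * x⁻¹) := by
  rw [show q * p * (q * x)⁻¹ = p * x⁻¹ by rw [mul_inv]; field_simp,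
    qpPoch_eq_qPoch_mul hq hp (p * x⁻¹), mul_assoc q]

lemma ellGamma_mul_left (hq0 : q ≠ 0) (hq : ‖q‖ < 1) (hp : ‖p‖ < 1) (hx : qPoch p x ≠ 0) :
    ellGamma q p (q * x) = ellGamma q p x * (theta p x / qPoch p p) := by
  have hpp := qPoch_self_ne_zero hp
  rw [ellGamma, ellGamma, theta, qpPoch_mul_inv_mul_left hq0 hq hp, qpPoch_eq_qPoch_mul hq hp x]
  field_simp

lemma inv_ellGamma_mul_left (hq0 : q ≠ 0) (hq : ‖q‖ < 1) (hp : ‖p‖ < 1)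
    (hx : qPoch p (p * x⁻¹) ≠ 0) :
    (ellGamma q p x)⁻¹ = (ellGamma q p (q * x))⁻¹ * (theta p x / qPoch p p) := by
  have hpp := qPoch_self_ne_zero hp
  rw [ellGamma, ellGamma, theta, qpPoch_mul_inv_mul_left hq0 hq hp, qpPoch_eq_qPoch_mul hq hp x,
    inv_div, inv_div]
  generalize qPoch p (p * x⁻¹) = A at hx ⊢
  generalize qpPoch q p (q * p * x⁻¹) = B
  field_simp

variable {ι : Type*} {l : Filter ι} {pl xl : ι → ℂ}

lemma tendsto_ellGamma (hq : ‖q‖ < 1) (hp : ‖p‖ < 1) (hx : x ≠ 0) (hden : qpPoch q p x ≠ 0)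
    (hpl : Tendsto pl l (𝓝 p)) (hxl : Tendsto xl l (𝓝 x)) :
    Tendsto (fun s => ellGamma q (pl s) (xl s)) l (𝓝 (ellGamma q p x)) :=
  (tendsto_qpPoch hq hp hpl ((hpl.const_mul q).mul (hxl.inv₀ hx))).div
    (tendsto_qpPoch hq hp hpl hxl) hden

lemma tendsto_inv_ellGamma (hq : ‖q‖ < 1) (hp : ‖p‖ < 1) (hx : x ≠ 0)
    (hnum : qpPoch q p (q * p * x⁻¹) ≠ 0) (hpl : Tendsto pl l (𝓝 p))
    (hxl : Tendsto xl l (𝓝 x)) :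
    Tendsto (fun s => (ellGamma q (pl s) (xl s))⁻¹) l (𝓝 (ellGamma q p x)⁻¹) := by
  simp only [ellGamma, inv_div]
  exact (tendsto_qpPoch hq hp hpl hxl).div
    (tendsto_qpPoch hq hp hpl ((hpl.const_mul q).mul (hxl.inv₀ hx))) hnum

end EllipticGamma

section Logarithms

variable {q p u : ℂ}

lemma one_sub_pow_ne_zero (hq : ‖q‖ < 1) (n : ℕ+) : 1 - q ^ (n : ℕ) ≠ 0 := fun h => by
  have hnorm := congrArg norm (sub_eq_zero.mp h)
  rw [norm_one, norm_pow] at hnorm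
  exact (pow_lt_one₀ (norm_nonneg q) hq n.ne_zero).ne hnorm.symm

lemma summable_pow_div_pnat {ι : Type*} {c : ι → ℂ} {ρ : ℝ} (hc : Summable fun i => ‖c i‖)
    (hρ : ρ < 1) (hcρ : ∀ i, ‖c i‖ ≤ ρ) :
    Summable fun k : ι × ℕ+ => c k.1 ^ (k.2 : ℕ) / (k.2 : ℂ) := by
  rcases isEmpty_or_nonempty ι with h | ⟨⟨i₀⟩⟩
  · exact summable_empty
  have hρ0 : 0 ≤ ρ := (norm_nonneg _).trans (hcρ i₀)
  have hgeom : Summable fun n : ℕ+ => ρ ^ ((n : ℕ) - 1) :=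
    (Equiv.pnatEquivNat.summable_iff (f := fun n => ρ ^ n)).mpr
      (summable_geometric_of_lt_one hρ0 hρ)
  refine .of_norm_bounded (hc.mul_of_nonneg hgeom (fun _ => norm_nonneg _)
    (fun _ => by positivity)) fun ⟨i, n⟩ => ?_
  have hn : (1 : ℝ) ≤ ‖(n : ℂ)‖ := by
    rw [Complex.norm_natCast]
    exact_mod_cast one_le
  calc ‖c i ^ (n : ℕ) / (n : ℂ)‖ ≤ ‖c i‖ ^ (n : ℕ) := by
        rw [norm_div, norm_pow]
        exact div_le_self (by positivity) hn
    _ = ‖c i‖ * ‖c i‖ ^ ((n : ℕ) - 1) := (mul_pow_sub_one n.ne_zero _).symm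
    _ ≤ ‖c i‖ * ρ ^ ((n : ℕ) - 1) := by gcongr; exact hcρ i

lemma hasSum_pow_div_pnat (hu : ‖u‖ < 1) :
    HasSum (fun n : ℕ+ => u ^ (n : ℕ) / (n : ℂ)) (-Complex.log (1 - u)) := by
  refine (hasSum_pnat_iff (f := fun n : ℕ => u ^ n / (n : ℂ))).mpr ?_
  simpa using Complex.hasSum_taylorSeries_neg_log hu

/-- `-log (u; q, p)_∞`, the sum of the principal logarithms of the factors. -/
noncomputable def pochLog (q p u : ℂ) : ℂ :=
  ∑' k : ℕ × ℕ, -Complex.log (1 - u * q ^ k.1 * p ^ k.2)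

lemma hasSum_mul_pow_mul_pow_pow (hq : ‖q‖ < 1) (hp : ‖p‖ < 1) (u : ℂ) (n : ℕ+) :
    HasSum (fun k : ℕ × ℕ => (u * q ^ k.1 * p ^ k.2) ^ (n : ℕ))
      (u ^ (n : ℕ) / ((1 - q ^ (n : ℕ)) * (1 - p ^ (n : ℕ)))) := by
  have hpow {a : ℂ} (ha : ‖a‖ < 1) : ‖a ^ (n : ℕ)‖ < 1 := by
    rw [norm_pow]
    exact pow_lt_one₀ (norm_nonneg _) ha n.ne_zero
  have hnorm {a : ℂ} (ha : ‖a‖ < 1) : Summable fun m : ℕ => ‖(a ^ (n : ℕ)) ^ m‖ :=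
    (summable_geometric_of_norm_lt_one (hpow ha)).norm
  have hgeom := ((hasSum_geometric_of_norm_lt_one (hpow hq)).mul
    (hasSum_geometric_of_norm_lt_one (hpow hp))
    (summable_mul_of_summable_norm (hnorm hq) (hnorm hp))).mul_left (u ^ (n : ℕ))
  convert! hgeom using 1
  · ext k
    simp only [mul_pow]
    ring
  · rw [div_eq_mul_inv, mul_inv]

lemma hasSum_pochLog_prod (hq : ‖q‖ < 1) (hp : ‖p‖ < 1) (hu : ‖u‖ < 1) :
    HasSum (fun k : (ℕ × ℕ) × ℕ+ => (u * q ^ k.1.1 * p ^ k.1.2) ^ (k.2 : ℕ) / (k.2 : ℂ))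
      (pochLog q p u) := by
  have hle (k : ℕ × ℕ) := norm_mul_pow_mul_pow_le (x := u) hq hp k.1 k.2
  have hsum := (summable_pow_div_pnat (summable_norm_mul_pow_mul_pow hq hp u) hu hle).hasSum
  have hfib (k : ℕ × ℕ) := hasSum_pow_div_pnat ((hle k).trans_lt hu)
  rw [pochLog, (hsum.prod_fiberwise hfib).tsum_eq]
  exact hsum

lemma hasSum_pochLog (hq : ‖q‖ < 1) (hp : ‖p‖ < 1) (hu : ‖u‖ < 1) :
    HasSum (fun n : ℕ+ => u ^ (n : ℕ) / ((1 - q ^ (n : ℕ)) * (1 - p ^ (n : ℕ))) / (n : ℂ))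
      (pochLog q p u) := by
  have hswap : HasSum (fun k : ℕ+ × (ℕ × ℕ) => (u * q ^ k.2.1 * p ^ k.2.2) ^ (k.1 : ℕ) / (k.1 : ℂ))
      (pochLog q p u) :=
    (Equiv.prodComm ℕ+ (ℕ × ℕ)).hasSum_iff.mpr (hasSum_pochLog_prod hq hp hu)
  exact hswap.prod_fiberwise fun n => (hasSum_mul_pow_mul_pow_pow hq hp u n).div_const (n : ℂ)

lemma exp_pochLog (hq : ‖q‖ < 1) (hp : ‖p‖ < 1) (hu : ‖u‖ < 1) :
    Complex.exp (pochLog q p u) = (qpPoch q p u)⁻¹ := by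
  have hlt (k : ℕ × ℕ) : ‖u * q ^ k.1 * p ^ k.2‖ < 1 :=
    (norm_mul_pow_mul_pow_le hq hp k.1 k.2).trans_lt hu
  have hne (k : ℕ × ℕ) : 1 - u * q ^ k.1 * p ^ k.2 ≠ 0 := fun h =>
    (hlt k).ne (by rw [← sub_eq_zero.mp h, norm_one])
  have hfib (k : ℕ × ℕ) := hasSum_pow_div_pnat (hlt k)
  have hlog := (hasSum_pochLog_prod hq hp hu).prod_fiberwise hfib
  have hprod := Complex.hasProd_of_hasSum_log hne (by simpa only [neg_neg] using hlog.neg)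
  rw [qpPoch, hprod.tprod_eq, Complex.exp_neg, inv_inv]

end Logarithms

section CircleAverage

open Metric Real

variable {f : ℂ → ℂ} {r R : ℝ} {w : ℂ}

lemma circleAverage_comp_mul (f : ℂ → ℂ) (c : ℂ) (r : ℝ) :
    circleAverage (fun z => f (c * z)) 0 r = circleAverage f 0 (‖c‖ * r) := by
  rw [circleAverage_eq_integral_add (f := f) c.arg, circleAverage_def]
  congr 2
  ext θ
  congr 1
  have hpolar := Complex.norm_mul_exp_arg_mul_I c
  simp only [circleMap, zero_add]
  push_cast
  rw [add_mul, Complex.exp_add]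
  linear_combination -((r : ℂ) * Complex.exp (θ * Complex.I)) * hpolar

lemma circleAverage_zpow (hr : 0 < r) (d : ℤ) :
    circleAverage (fun z : ℂ => z ^ d) 0 r = if d = 0 then 1 else 0 := by
  split_ifs with hd
  · simp [hd, circleAverage_const]
  · have hintegrand : Set.EqOn (fun z : ℂ => (z - 0)⁻¹ • z ^ d) (fun z => (z - 0) ^ (d - 1))
        (sphere 0 r) := fun z hz => by
      have hz0 : z ≠ 0 := ne_of_mem_sphere hz hr.ne'
      simp only [sub_zero, smul_eq_mul, zpow_sub_one₀ hz0, mul_comm]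
    rw [circleAverage_eq_circleIntegral hr.ne', circleIntegral.integral_congr hr.le hintegrand,
      circleIntegral.integral_sub_zpow_of_ne (by omega), smul_zero]

lemma hasSum_circleAverage {ι : Type*} [Countable ι] {F : ι → ℂ → ℂ} {b : ι → ℝ} (hr : 0 ≤ r)
    (hF : ∀ i, ContinuousOn (F i) (sphere 0 r)) (hb : Summable b)
    (hFb : ∀ i, ∀ z ∈ sphere (0 : ℂ) r, ‖F i z‖ ≤ b i)
    (hf : ∀ z ∈ sphere (0 : ℂ) r, HasSum (fun i => F i z) (f z)) :
    HasSum (fun i => circleAverage (F i) 0 r) (circleAverage f 0 r) := by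
  have hmem (θ : ℝ) : circleMap 0 r θ ∈ sphere (0 : ℂ) r := circleMap_mem_sphere 0 hr θ
  have hcont (i : ι) : Continuous fun θ => F i (circleMap 0 r θ) :=
    (hF i).comp_continuous (continuous_circleMap 0 r) hmem
  simp only [circleAverage_def]
  refine (intervalIntegral.hasSum_integral_of_dominated_convergence (fun i _ => b i)
    (fun i => (hcont i).aestronglyMeasurable) (fun i => ?_) ?_ ?_ ?_).const_smul _
  · exact .of_forall fun θ _ => hFb i _ (hmem θ)
  · exact .of_forall fun _ _ => hb
  · exact intervalIntegrable_const
  · exact .of_forall fun θ _ => hf _ (hmem θ)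

lemma hasSum_circleAverage_monomials {ι : Type*} [Countable ι] {a : ι → ℂ} {d : ι → ℤ}
    (hr : 0 < r) (hf : ∀ z ∈ sphere (0 : ℂ) r, HasSum (fun i => a i * z ^ d i) (f z)) :
    HasSum (fun i => if d i = 0 then a i else 0) (circleAverage f 0 r) := by
  have hne {z : ℂ} (hz : z ∈ sphere 0 r) : z ≠ 0 := ne_of_mem_sphere hz hr.ne'
  have hsum : Summable fun i => ‖a i‖ * r ^ d i := by
    simpa [abs_of_pos hr] using (hf r (by simp [abs_of_pos hr])).summable.norm
  have hterm (i : ι) : circleAverage (fun z => a i * z ^ d i) 0 r = if d i = 0 then a i else 0 := by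
    simp only [← smul_eq_mul, circleAverage_fun_smul, circleAverage_zpow hr]
    simp
  simp only [← hterm]
  refine hasSum_circleAverage hr.le (fun i => ?_) hsum (fun i z hz => ?_) hf
  · exact continuousOn_const.mul (continuousOn_id.zpow₀ _ fun z hz => .inl (hne hz))
  · rw [norm_mul, norm_zpow, mem_sphere_zero_iff_norm.mp hz]

lemma circleAverage_eq_of_annulus {s : Set ℂ} (hr : 0 < r) (hrR : r ≤ R) (hs : s.Countable)
    (hc : ∀ z, ‖z‖ ∈ Set.Icc r R → ContinuousAt f z)
    (hd : ∀ z, ‖z‖ ∈ Set.Icc r R → z ∉ s → DifferentiableAt ℂ f z) :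
    circleAverage f 0 R = circleAverage f 0 r := by
  rw [circleAverage_eq_circleIntegral hr.ne', circleAverage_eq_circleIntegral (hr.trans_le hrR).ne',
    Complex.circleIntegral_sub_center_inv_smul_eq_of_differentiable_on_annulus_off_countable hr hrR
      hs]
  · rintro z ⟨hzR, hzr⟩
    simp only [mem_closedBall_zero_iff, mem_ball_zero_iff, not_lt] at hzR hzr
    exact (hc z ⟨hzr, hzR⟩).continuousWithinAt
  · rintro z ⟨⟨hzR, hzr⟩, hzs⟩
    simp only [mem_closedBall_zero_iff, mem_ball_zero_iff, not_le] at hzR hzr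
    exact hd z ⟨hzr.le, hzR.le⟩ hzs

lemma one_sub_div_ne_zero {z w : ℂ} (hw : w ≠ 0) (hzw : z ≠ w) : 1 - z / w ≠ 0 := by
  rwa [sub_ne_zero, ne_comm, Ne, div_eq_one_iff_eq hw]

lemma circleAverage_one_sub_div_inv_of_lt (hr : |r| < ‖w‖) :
    circleAverage (fun z => (1 - z / w)⁻¹) 0 r = 1 := by
  have hw : w ≠ 0 := norm_pos_iff.mp ((abs_nonneg r).trans_lt hr)
  have hdiff : DifferentiableOn ℂ (fun z => (1 - z / w)⁻¹) (closedBall 0 |r|) := fun z hz => by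
    have hzw : z ≠ w := by
      rintro rfl
      exact hr.not_ge (mem_closedBall_zero_iff.mp hz)
    have hlin : DifferentiableAt ℂ (fun z => 1 - z / w) z := by fun_prop
    exact (hlin.fun_inv (one_sub_div_ne_zero hw hzw)).differentiableWithinAt
  rw [DiffContOnCl.circleAverage (hdiff.mono closure_ball_subset_closedBall).diffContOnCl]
  simp

lemma circleAverage_one_sub_div_inv_of_gt (hw : w ≠ 0) (hR : ‖w‖ < |R|) :
    circleAverage (fun z => (1 - z / w)⁻¹) 0 R = 0 := by
  have hcauchy : circleAverage (fun z => (z - 0) / (z - w) * 1) 0 R = 1 :=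
    DiffContOnCl.circleAverage_smul_div diffContOnCl_const (mem_ball_zero_iff.mpr hR)
  have hsub {z : ℂ} (hz : z ∈ sphere 0 |R|) : z - w ≠ 0 := by
    rw [sub_ne_zero]
    rintro rfl
    exact hR.ne (mem_sphere_zero_iff_norm.mp hz)
  have hint : CircleIntegrable (fun z => (z - 0) / (z - w) * 1) 0 R :=
    ContinuousOn.circleIntegrable' <|
      (ContinuousOn.div (by fun_prop) (by fun_prop) fun z hz => hsub hz).mul continuousOn_const
  have hcongr : Set.EqOn (fun z => (1 - z / w)⁻¹) (fun z => 1 - (z - 0) / (z - w) * 1)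
      (sphere 0 |R|) := fun z hz => by
    have hzw := hsub hz
    have hwz : w - z ≠ 0 := by rwa [← neg_sub, neg_ne_zero]
    field_simp
    ring
  rw [circleAverage_congr_sphere hcongr,
    circleAverage_fun_sub (circleIntegrable_const 1 0 R) hint, hcauchy, circleAverage_const,
    sub_self]

-- Removing the pole at `w` leaves a multiple of the difference quotient of `f` at `w`, which has
-- the same average over circles on either side of `w`.
lemma circleAverage_mul_one_sub_div_inv (hr : 0 < r) (hf : ∀ z ∈ sphere 0 r, ContinuousAt f z)
    (hw : w ≠ 0) (hwr : ‖w‖ ≠ r) :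
    circleAverage (fun z => f z * (1 - z / w)⁻¹) 0 r =
      f w * circleAverage (fun z => (1 - z / w)⁻¹) 0 r - w * circleAverage (dslope f w) 0 r := by
  have hne {z : ℂ} (hz : z ∈ sphere 0 |r|) : z ≠ w := by
    rintro rfl
    exact hwr (by rwa [abs_of_pos hr, mem_sphere_zero_iff_norm] at hz)
  have hpole : CircleIntegrable (fun z => f w • (1 - z / w)⁻¹) 0 r :=
    ContinuousOn.circleIntegrable' <| continuousOn_const.fun_smul <|
      ContinuousOn.fun_inv₀ (by fun_prop) fun z hz => one_sub_div_ne_zero hw (hne hz)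
  have hslope : CircleIntegrable (fun z => w • dslope f w z) 0 r :=
    ContinuousOn.circleIntegrable' <| continuousOn_const.fun_smul fun z hz =>
      ((continuousAt_dslope_of_ne (hne hz)).mpr
        (hf z (by rwa [abs_of_pos hr] at hz))).continuousWithinAt
  have hsplit : Set.EqOn (fun z => f z * (1 - z / w)⁻¹)
      (fun z => f w • (1 - z / w)⁻¹ - w • dslope f w z) (sphere 0 |r|) := fun z hz => by
    have hzw : z - w ≠ 0 := sub_ne_zero.mpr (hne hz)
    have hwz : w - z ≠ 0 := by rwa [← neg_sub, neg_ne_zero]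
    simp only [dslope_of_ne f (hne hz), slope_def_field, smul_eq_mul]
    field_simp
    ring
  rw [circleAverage_congr_sphere hsplit, circleAverage_fun_sub hpole hslope,
    circleAverage_fun_smul, circleAverage_fun_smul, smul_eq_mul, smul_eq_mul]

lemma circleAverage_sub_circleAverage_of_pole
    (hf : ∀ z, ‖z‖ ∈ Set.Icc r R → DifferentiableAt ℂ f z) (hr : 0 < r) (hrw : r < ‖w‖)
    (hwR : ‖w‖ < R) :
    circleAverage (fun z => f z * (1 - z / w)⁻¹) 0 r -
      circleAverage (fun z => f z * (1 - z / w)⁻¹) 0 R = f w := by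
  have hw : w ≠ 0 := norm_pos_iff.mp (hr.trans hrw)
  have hrR : r ≤ R := (hrw.trans hwR).le
  have hR : 0 < R := hr.trans_le hrR
  have hslope : circleAverage (dslope f w) 0 R = circleAverage (dslope f w) 0 r := by
    refine circleAverage_eq_of_annulus hr hrR (Set.countable_singleton w) (fun z hz => ?_)
      fun z hz hzw => (differentiableAt_dslope_of_ne hzw).mpr (hf z hz)
    rcases eq_or_ne z w with rfl | hzw
    · exact continuousAt_dslope_same.mpr (hf z hz)
    · exact (continuousAt_dslope_of_ne hzw).mpr (hf z hz).continuousAt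
  have hcont {ρ : ℝ} (hρ : ρ ∈ Set.Icc r R) : ∀ z ∈ sphere 0 ρ, ContinuousAt f z := fun z hz =>
    (hf z (mem_sphere_zero_iff_norm.mp hz ▸ hρ)).continuousAt
  rw [circleAverage_mul_one_sub_div_inv hr (hcont ⟨le_rfl, hrR⟩) hw hrw.ne',
    circleAverage_mul_one_sub_div_inv hR (hcont ⟨hrR, le_rfl⟩) hw hwR.ne, hslope,
    circleAverage_one_sub_div_inv_of_lt (by rwa [abs_of_pos hr]),
    circleAverage_one_sub_div_inv_of_gt hw (by rwa [abs_of_pos hR])]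
  ring

section SimplePoles

variable {κ : Type*} [Fintype κ] [DecidableEq κ] [Nonempty κ] {w : κ → ℂ}

lemma prod_one_sub_div_inv_eq_sum (hinj : Function.Injective w) (hw : ∀ k, w k ≠ 0) {z : ℂ}
    (hz : ∀ k, z ≠ w k) :
    ∏ k, (1 - z / w k)⁻¹ =
      ∑ k, (∏ l ∈ Finset.univ.erase k, (1 - w k / w l)⁻¹) * (1 - z / w k)⁻¹ := by
  have hlagrange := congrArg (Polynomial.eval z)
    (Lagrange.sum_basis (s := Finset.univ) (v := w) hinj.injOn Finset.univ_nonempty)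
  simp only [Polynomial.eval_finsetSum, Polynomial.eval_one, Lagrange.basis,
    Polynomial.eval_prod, Lagrange.basisDivisor, Polynomial.eval_mul, Polynomial.eval_C,
    Polynomial.eval_sub, Polynomial.eval_X] at hlagrange
  have hbasis (k l : κ) (hl : l ∈ Finset.univ.erase k) :
      (1 - z / w l)⁻¹ * ((w k - w l)⁻¹ * (z - w l)) = (1 - w k / w l)⁻¹ := by
    have hkl : w k - w l ≠ 0 := sub_ne_zero.mpr (hinj.ne (Finset.ne_of_mem_erase hl).symm)
    have hlk : w l - w k ≠ 0 := by rwa [← neg_sub, neg_ne_zero]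
    have hzl : w l - z ≠ 0 := sub_ne_zero.mpr (hz l).symm
    have hl0 := hw l
    field_simp
    ring
  have hexpand := congrArg ((∏ k, (1 - z / w k)⁻¹) * ·) hlagrange.symm
  simp only [mul_one, Finset.mul_sum] at hexpand
  rw [hexpand]
  refine Finset.sum_congr rfl fun k _ => ?_
  rw [← Finset.mul_prod_erase _ _ (Finset.mem_univ k), mul_assoc, ← Finset.prod_mul_distrib,
    mul_comm, Finset.prod_congr rfl (hbasis k)]

lemma circleAverage_sub_circleAverage_of_poles
    (hf : ∀ z, ‖z‖ ∈ Set.Icc r R → DifferentiableAt ℂ f z) (hr : 0 < r)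
    (hinj : Function.Injective w) (hrw : ∀ k, r < ‖w k‖) (hwR : ∀ k, ‖w k‖ < R) :
    circleAverage (fun z => f z * ∏ k, (1 - z / w k)⁻¹) 0 r -
      circleAverage (fun z => f z * ∏ k, (1 - z / w k)⁻¹) 0 R =
      ∑ k, (∏ l ∈ Finset.univ.erase k, (1 - w k / w l)⁻¹) * f (w k) := by
  obtain ⟨k₀⟩ := ‹Nonempty κ›
  have hw (k : κ) : w k ≠ 0 := norm_pos_iff.mp (hr.trans (hrw k))
  have hrR : r ≤ R := ((hrw k₀).trans (hwR k₀)).le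
  have hsplit {ρ : ℝ} (hρ : ρ ∈ Set.Icc r R) (hρw : ∀ k, ‖w k‖ ≠ ρ) :
      circleAverage (fun z => f z * ∏ k, (1 - z / w k)⁻¹) 0 ρ =
        ∑ k, (∏ l ∈ Finset.univ.erase k, (1 - w k / w l)⁻¹) *
          circleAverage (fun z => f z * (1 - z / w k)⁻¹) 0 ρ := by
    have hρ0 : 0 < ρ := hr.trans_le hρ.1
    have hne {z : ℂ} (hz : z ∈ sphere 0 |ρ|) (k : κ) : z ≠ w k := by
      rintro rfl
      exact hρw k (by rwa [abs_of_pos hρ0, mem_sphere_zero_iff_norm] at hz)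
    have hcont : ContinuousOn f (sphere 0 |ρ|) := fun z hz => by
      rw [abs_of_pos hρ0, mem_sphere_zero_iff_norm] at hz
      exact (hf z (hz ▸ hρ)).continuousAt.continuousWithinAt
    have hint (k : κ) : CircleIntegrable (fun z =>
        (∏ l ∈ Finset.univ.erase k, (1 - w k / w l)⁻¹) • (f z * (1 - z / w k)⁻¹)) 0 ρ :=
      ContinuousOn.circleIntegrable' <| continuousOn_const.fun_smul <| hcont.fun_mul <|
        ContinuousOn.fun_inv₀ (by fun_prop) fun z hz => one_sub_div_ne_zero (hw k) (hne hz k)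
    have hsum : Set.EqOn (fun z => f z * ∏ k, (1 - z / w k)⁻¹)
        (fun z => ∑ k, (∏ l ∈ Finset.univ.erase k, (1 - w k / w l)⁻¹) •
          (f z * (1 - z / w k)⁻¹)) (sphere 0 |ρ|) := fun z hz => by
      simp only [prod_one_sub_div_inv_eq_sum hinj hw (hne hz), Finset.mul_sum, smul_eq_mul,
        mul_left_comm]
    rw [circleAverage_congr_sphere hsum, circleAverage_fun_sum fun k _ => hint k]
    exact Finset.sum_congr rfl fun k _ => circleAverage_fun_smul
  rw [hsplit ⟨le_rfl, hrR⟩ fun k => (hrw k).ne', hsplit ⟨hrR, le_rfl⟩ fun k => (hwR k).ne,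
    ← Finset.sum_sub_distrib]
  refine Finset.sum_congr rfl fun k _ => ?_
  rw [← mul_sub, circleAverage_sub_circleAverage_of_pole hf hr (hrw k) (hwR k)]

end SimplePoles

end CircleAverage

section Laurent

open Metric Real

variable {f : ℂ → ℂ} {r : ℝ} {w : ℂ}

lemma HasLaurentExpansionOn.mono {A B : Set ℂ} {a : ℤ → ℂ} (hf : HasLaurentExpansionOn f A a)
    (hBA : B ⊆ A) : HasLaurentExpansionOn f B a := fun z hz => hf z (hBA hz)

lemma HasLaurentExpansionOn.circleAverage_eq {a : ℤ → ℂ} (hr : 0 < r)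
    (hf : HasLaurentExpansionOn f (sphere 0 r) a) : circleAverage f 0 r = a 0 :=
  (hasSum_circleAverage_monomials (d := id) hr hf).unique
    (hasSum_single (f := fun n : ℤ => if n = 0 then a n else 0) 0 fun _ hn => if_neg hn)

lemma constantTerm_eq_circleAverage {A : Set ℂ} (hr : 0 < r) (hrA : sphere 0 r ⊆ A)
    (hf : ∃ a, HasLaurentExpansionOn f A a) : constantTerm f A = circleAverage f 0 r := by
  rw [constantTerm, dif_pos hf, (hf.choose_spec.mono hrA).circleAverage_eq hr]

/-- The `n`-th Laurent coefficient of `f`, computed on the circle of radius `r`. -/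
noncomputable def laurentCoeff (f : ℂ → ℂ) (r : ℝ) (n : ℤ) : ℂ :=
  circleAverage (fun z => f z * z ^ (-n)) 0 r

lemma hasSum_laurentCoeff_of_hasSum (hr : 0 < r) (hf : ContinuousOn f (sphere 0 r)) (hw : w ≠ 0)
    {g : ℂ → ℂ} {d : ℕ → ℤ} (hsum : Summable fun n => (r / ‖w‖) ^ (-d n))
    (hg : ∀ z ∈ sphere (0 : ℂ) r, HasSum (fun n => (z / w) ^ (-d n)) (g z)) :
    HasSum (fun n => laurentCoeff f r (d n) * w ^ d n)
      (circleAverage (fun z => f z * g z) 0 r) := by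
  obtain ⟨B, hB⟩ := (isCompact_sphere (0 : ℂ) r).exists_bound_of_continuousOn hf
  have hterm (n : ℕ) : laurentCoeff f r (d n) * w ^ d n =
      circleAverage (fun z => f z * (z / w) ^ (-d n)) 0 r := by
    rw [laurentCoeff, mul_comm, ← smul_eq_mul, ← circleAverage_fun_smul]
    refine congrArg (circleAverage · 0 r) (funext fun z => ?_)
    rw [div_zpow, zpow_neg w, div_inv_eq_mul, smul_eq_mul]
    ring
  simp only [hterm]
  refine hasSum_circleAverage hr.le (fun n => hf.mul ?_) (hsum.mul_left B) (fun n z hz => ?_)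
    fun z hz => (hg z hz).mul_left (f z)
  · refine ContinuousOn.zpow₀ (by fun_prop) _ fun z hz => .inl ?_
    exact div_ne_zero (ne_of_mem_sphere hz hr.ne') hw
  · rw [norm_mul, norm_zpow, norm_div, mem_sphere_zero_iff_norm.mp hz]
    gcongr
    exact hB z hz

lemma hasSum_laurentCoeff_nonpos (hr : 0 < r) (hf : ContinuousOn f (sphere 0 r))
    (hw : r < ‖w‖) :
    HasSum (fun n : ℕ => laurentCoeff f r (-n) * w ^ (-n : ℤ))
      (circleAverage (fun z => f z * (1 - z / w)⁻¹) 0 r) := by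
  have hratio : r / ‖w‖ < 1 := (div_lt_one (hr.trans hw)).mpr hw
  refine hasSum_laurentCoeff_of_hasSum hr hf (norm_pos_iff.mp (hr.trans hw)) ?_ fun z hz => ?_
  · simpa using summable_geometric_of_lt_one (by positivity) hratio
  · have hnorm : ‖z / w‖ < 1 := by rwa [norm_div, mem_sphere_zero_iff_norm.mp hz]
    simpa using hasSum_geometric_of_norm_lt_one hnorm

lemma hasSum_laurentCoeff_pos (hr : 0 < r) (hf : ContinuousOn f (sphere 0 r)) (hw : w ≠ 0)
    (hwr : ‖w‖ < r) :
    HasSum (fun n : ℕ => laurentCoeff f r (n + 1) * w ^ (n + 1 : ℤ))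
      (-circleAverage (fun z => f z * (1 - z / w)⁻¹) 0 r) := by
  have hratio : ‖w‖ / r < 1 := (div_lt_one hr).mpr hwr
  have hneg : -circleAverage (fun z => f z * (1 - z / w)⁻¹) 0 r =
      circleAverage (fun z => f z * -(1 - z / w)⁻¹) 0 r := by
    rw [← neg_one_smul ℂ, ← circleAverage_fun_smul]
    simp
  rw [hneg]
  refine hasSum_laurentCoeff_of_hasSum hr hf hw ?_ fun z hz => ?_
  · refine ((summable_geometric_of_lt_one (by positivity) hratio).mul_left (‖w‖ / r)).congr
      fun n => ?_
    rw [zpow_neg, ← inv_zpow, inv_div, ← pow_succ', ← zpow_natCast, Nat.cast_succ]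
  · have hz0 : z ≠ 0 := ne_of_mem_sphere hz hr.ne'
    have hnorm : ‖w / z‖ < 1 := by rwa [norm_div, mem_sphere_zero_iff_norm.mp hz]
    have hzw : z ≠ w := by
      rintro rfl
      exact hwr.ne (mem_sphere_zero_iff_norm.mp hz)
    have hvalue : w / z * (1 - w / z)⁻¹ = -(1 - z / w)⁻¹ := by
      have hzw' : z - w ≠ 0 := sub_ne_zero.mpr hzw
      have hwz' : w - z ≠ 0 := sub_ne_zero.mpr hzw.symm
      field_simp
      ring
    rw [← hvalue]
    refine ((hasSum_geometric_of_norm_lt_one hnorm).mul_left (w / z)).congr_fun fun n => ?_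
    rw [zpow_neg, ← inv_zpow, inv_div, ← pow_succ', ← zpow_natCast, Nat.cast_succ]

lemma laurentCoeff_eq_of_annulus {R : ℝ} (hr : 0 < r) (hrR : r ≤ R)
    (hf : ∀ z, ‖z‖ ∈ Set.Icc r R → DifferentiableAt ℂ f z) (n : ℤ) :
    laurentCoeff f R n = laurentCoeff f r n := by
  have hdiff (z : ℂ) (hz : ‖z‖ ∈ Set.Icc r R) :
      DifferentiableAt ℂ (fun z => f z * z ^ (-n)) z :=
    (hf z hz).fun_mul (differentiableAt_zpow.mpr (.inl (norm_pos_iff.mp (hr.trans_le hz.1))))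
  exact circleAverage_eq_of_annulus hr hrR Set.countable_empty
    (fun z hz => (hdiff z hz).continuousAt) fun z hz _ => hdiff z hz

lemma exists_hasLaurentExpansionOn {s : Set ℝ} (hs : IsOpen s) (hconn : s.OrdConnected)
    (hpos : s ⊆ Set.Ioi 0) (hf : ∀ z, ‖z‖ ∈ s → DifferentiableAt ℂ f z) :
    ∃ a, HasLaurentExpansionOn f {z | ‖z‖ ∈ s} a := by
  rcases s.eq_empty_or_nonempty with rfl | ⟨ρ, hρ⟩
  · exact ⟨0, fun z hz => hz.elim⟩
  have hcoeff {r : ℝ} (hr : r ∈ s) : laurentCoeff f r = laurentCoeff f ρ := by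
    funext n
    rcases le_total r ρ with h | h
    · exact (laurentCoeff_eq_of_annulus (hpos hr) h
        (fun z hz => hf z (hconn.out hr hρ hz)) n).symm
    · exact laurentCoeff_eq_of_annulus (hpos hρ) h (fun z hz => hf z (hconn.out hρ hr hz)) n
  have hcont {r : ℝ} (hr : r ∈ s) : ContinuousOn f (sphere 0 r) := fun z hz =>
    (hf z (by rwa [mem_sphere_zero_iff_norm.mp hz])).continuousAt.continuousWithinAt
  refine ⟨laurentCoeff f ρ, fun z hz => ?_⟩
  have hz0 : z ≠ 0 := norm_pos_iff.mp (hpos hz)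
  obtain ⟨r, R, hzrR, hrRs⟩ : ∃ r R, ‖z‖ ∈ Set.Ioo r R ∧ Set.Icc r R ⊆ s := by
    obtain ⟨r, R, -, hrR, hsub⟩ := exists_Icc_mem_subset_of_mem_nhds (hs.mem_nhds hz)
    exact ⟨r, R, Icc_mem_nhds_iff.mp hrR, hsub⟩
  have hrR : r ≤ R := (hzrR.1.trans hzrR.2).le
  have hr : r ∈ s := hrRs ⟨le_rfl, hrR⟩
  have hR : R ∈ s := hrRs ⟨hrR, le_rfl⟩
  have hnonpos := hasSum_laurentCoeff_nonpos (hpos hr) (hcont hr) hzrR.1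
  have hpositive := hasSum_laurentCoeff_pos (hpos hR) (hcont hR) hz0 hzrR.2
  rw [hcoeff hr] at hnonpos
  rw [hcoeff hR] at hpositive
  rw [← circleAverage_sub_circleAverage_of_pole (fun z hz => hf z (hrRs hz)) (hpos hr) hzrR.1
    hzrR.2, sub_eq_add_neg, ← (Equiv.neg ℤ).hasSum_iff]
  refine HasSum.of_nat_of_neg_add_one hnonpos ?_
  simpa [Function.comp_def] using hpositive

end Laurent

section ThetaRatios

open Metric Real

variable {p v u z : ℂ}

/-- The quotient `θ_p(v z) / θ_p(u z)` with its pole at `z = u⁻¹`, that is the factor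
`(1 - u z)⁻¹`, removed. -/
noncomputable def thetaRegular (p v u z : ℂ) : ℂ :=
  qPoch p (v * z) / qPoch p (p * u * z) * (qPoch p (p * v⁻¹ * z⁻¹) / qPoch p (p * u⁻¹ * z⁻¹))

lemma theta_div_theta (hp : ‖p‖ < 1) (v u z : ℂ) :
    theta p (v * z) / theta p (u * z) = thetaRegular p v u z * (1 - u * z)⁻¹ := by
  have hpp := qPoch_self_ne_zero hp
  rw [theta_eq_one_sub_mul hp (u * z), theta, thetaRegular, mul_inv, mul_inv]
  simp only [← mul_assoc, div_eq_mul_inv, mul_inv]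
  field_simp

lemma thetaRegular_inv (hp : ‖p‖ < 1) (v : ℂ) (hu : u ≠ 0) :
    thetaRegular p v u u⁻¹ = theta p (v / u) / qPoch p p ^ 3 := by
  have hpp := qPoch_self_ne_zero hp
  have hargs : p * u * u⁻¹ = p ∧ p * u⁻¹ * u⁻¹⁻¹ = p ∧ p * v⁻¹ * u⁻¹⁻¹ = p * (v / u)⁻¹ := by
    refine ⟨mul_inv_cancel_right₀ hu p, mul_inv_cancel_right₀ (inv_ne_zero hu) p, ?_⟩
    rw [inv_div, inv_inv]
    ring
  rw [thetaRegular, theta, hargs.1, hargs.2.1, hargs.2.2, ← div_eq_mul_inv v u]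
  field_simp

lemma differentiableAt_thetaRegular (hp : ‖p‖ < 1) (v : ℂ) (hpz : ‖p‖ < ‖u * z‖)
    (hz : ‖p * u * z‖ < 1) : DifferentiableAt ℂ (thetaRegular p v u) z := by
  have huz : u * z ≠ 0 := norm_pos_iff.mp ((norm_nonneg p).trans_lt hpz)
  have hz0 : z ≠ 0 := right_ne_zero_of_mul huz
  have hinv : ‖p * u⁻¹ * z⁻¹‖ < 1 := by
    rw [mul_assoc, ← mul_inv]
    exact norm_mul_inv_lt_one hpz
  have hmul (a : ℂ) : DifferentiableAt ℂ (fun z => qPoch p (a * z)) z :=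
    (differentiable_qPoch hp _).comp z (differentiableAt_id.const_mul a)
  have hmul_inv (a : ℂ) : DifferentiableAt ℂ (fun z => qPoch p (a * z⁻¹)) z :=
    (differentiable_qPoch hp _).comp z ((differentiableAt_inv hz0).const_mul a)
  exact ((hmul v).div (hmul (p * u)) (qPoch_ne_zero_of_norm_lt_one hp hz)).mul
    ((hmul_inv (p * v⁻¹)).div (hmul_inv (p * u⁻¹)) (qPoch_ne_zero_of_norm_lt_one hp hinv))

lemma differentiableAt_theta_div_theta (hp : ‖p‖ < 1) (v : ℂ) (hpz : ‖p‖ < ‖u * z‖)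
    (hz : ‖u * z‖ < 1) : DifferentiableAt ℂ (fun z => theta p (v * z) / theta p (u * z)) z := by
  have hpuz : ‖p * u * z‖ < 1 := by
    rw [mul_assoc, norm_mul]
    exact mul_lt_one_of_nonneg_of_lt_one_left (norm_nonneg p) hp hz.le
  have hpole : 1 - u * z ≠ 0 := sub_ne_zero.mpr fun h => by simp [← h] at hz
  simp only [theta_div_theta hp]
  have hlin : DifferentiableAt ℂ (fun z => 1 - u * z) z := by fun_prop
  exact (differentiableAt_thetaRegular hp v hpz hpuz).mul (hlin.fun_inv hpole)

variable {κ : Type*} [Fintype κ] {v u : κ → ℂ} {r : ℝ}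

lemma exists_hasLaurentExpansionOn_prod_theta [Nonempty κ] (hp : ‖p‖ < 1) (v u : κ → ℂ) :
    ∃ a, HasLaurentExpansionOn (fun z => ∏ k, theta p (v k * z) / theta p (u k * z))
      {z | ∀ k, ‖p‖ < ‖u k * z‖ ∧ ‖u k * z‖ < 1} a := by
  have hradii : {z : ℂ | ∀ k, ‖p‖ < ‖u k * z‖ ∧ ‖u k * z‖ < 1} =
      {z | ‖z‖ ∈ ⋂ k, {ρ : ℝ | ‖u k‖ * ρ ∈ Set.Ioo ‖p‖ 1} ∩ Set.Ioi 0} := by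
    ext z
    have hpos (k : κ) (hk : ‖p‖ < ‖u k * z‖) : 0 < ‖z‖ :=
      norm_pos_iff.mpr (right_ne_zero_of_mul (norm_pos_iff.mp ((norm_nonneg p).trans_lt hk)))
    simp only [Set.mem_ofPred_eq, Set.mem_iInter, Set.mem_inter_iff, Set.mem_Ioo, Set.mem_Ioi,
      ← norm_mul]
    exact forall_congr' fun k => ⟨fun h => ⟨h, hpos k h.1⟩, And.left⟩
  rw [hradii]
  refine exists_hasLaurentExpansionOn ?_ ?_ ?_ fun z hz => ?_
  · exact isOpen_iInter_of_finite fun k =>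
      (isOpen_Ioo.preimage (continuous_const_mul ‖u k‖)).inter isOpen_Ioi
  · refine Set.ordConnected_iInter fun k => Set.OrdConnected.inter ?_ Set.ordConnected_Ioi
    exact Set.ordConnected_Ioo.preimage_mono
      (monotone_id.const_mul (norm_nonneg (u k)))
  · exact fun ρ hρ => (Set.mem_iInter.mp hρ (Classical.arbitrary κ)).2
  · have hzk : z ∈ {z | ∀ k, ‖p‖ < ‖u k * z‖ ∧ ‖u k * z‖ < 1} := hradii ▸ hz
    exact DifferentiableAt.fun_finsetProd fun k _ =>
      differentiableAt_theta_div_theta hp (v k) (hzk k).1 (hzk k).2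

lemma prod_theta_mul_left (hp : ‖p‖ < 1) (hp0 : p ≠ 0) (hv : ∀ k, v k ≠ 0) (hu : ∀ k, u k ≠ 0)
    (hz : z ≠ 0) :
    ∏ k, theta p (v k * (p * z)) / theta p (u k * (p * z)) =
      (∏ k, u k / v k) * ∏ k, theta p (v k * z) / theta p (u k * z) := by
  rw [← Finset.prod_mul_distrib]
  refine Finset.prod_congr rfl fun k _ => ?_
  have hvk := hv k
  have huk := hu k
  rw [mul_left_comm, mul_left_comm (u k), theta_mul_left hp hp0 (mul_ne_zero hvk hz),
    theta_mul_left hp hp0 (mul_ne_zero huk hz)]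
  simp only [div_eq_mul_inv, mul_inv, neg_mul, neg_inv.symm, inv_inv, mul_neg, neg_neg]
  field_simp

lemma circleAverage_prod_theta_inv_mul (hp : ‖p‖ < 1) (hp0 : p ≠ 0) (hv : ∀ k, v k ≠ 0)
    (hu : ∀ k, u k ≠ 0) (hr : 0 < r) :
    circleAverage (fun z => ∏ k, theta p (v k * z) / theta p (u k * z)) 0 (‖p⁻¹‖ * r) =
      (∏ k, u k / v k)⁻¹ *
        circleAverage (fun z => ∏ k, theta p (v k * z) / theta p (u k * z)) 0 r := by
  rw [← circleAverage_comp_mul, ← smul_eq_mul, ← circleAverage_fun_smul]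
  refine circleAverage_congr_sphere fun z hz => ?_
  have hz0 : z ≠ 0 := ne_of_mem_sphere hz (abs_pos.mpr hr.ne').ne'
  have hfactor : ∏ k, u k / v k ≠ 0 :=
    Finset.prod_ne_zero_iff.mpr fun k _ => div_ne_zero (hu k) (hv k)
  have hquasi := prod_theta_mul_left hp hp0 hv hu (mul_ne_zero (inv_ne_zero hp0) hz0)
  rw [mul_inv_cancel_left₀ hp0] at hquasi
  simp only [hquasi, smul_eq_mul, inv_mul_cancel_left₀ hfactor]

lemma differentiableAt_prod_thetaRegular (hp : ‖p‖ < 1) (hp0 : p ≠ 0)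
    (hpu : ∀ k, ‖p‖ < ‖u k‖ * r) (hu1 : ∀ k, ‖u k‖ * r < 1)
    (hz : ‖z‖ ∈ Set.Icc r (‖p⁻¹‖ * r)) :
    DifferentiableAt ℂ (fun z => ∏ k, thetaRegular p (v k) (u k) z) z := by
  refine DifferentiableAt.fun_finsetProd fun k _ =>
    differentiableAt_thetaRegular hp (v k) ?_ ?_
  · calc ‖p‖ < ‖u k‖ * r := hpu k
      _ ≤ ‖u k‖ * ‖z‖ := by gcongr; exact hz.1
      _ = ‖u k * z‖ := (norm_mul _ _).symm
  · calc ‖p * u k * z‖ = ‖p‖ * ‖u k‖ * ‖z‖ := by rw [norm_mul, norm_mul]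
      _ ≤ ‖p‖ * ‖u k‖ * (‖p⁻¹‖ * r) := by gcongr; exact hz.2
      _ = ‖u k‖ * r := by
        have := norm_ne_zero_iff.mpr hp0
        rw [norm_inv]
        field_simp
      _ < 1 := hu1 k

-- The circles of radii `r` and `r / |p|` bound a fundamental domain of `z ↦ p z`; it contains
-- exactly the poles `(u k)⁻¹`, whose residues are the terms on the right.
lemma circleAverage_prod_theta [DecidableEq κ] [Nonempty κ] (hp : ‖p‖ < 1) (hp0 : p ≠ 0)
    (hv : ∀ k, v k ≠ 0) (hinj : Function.Injective u) (hr : 0 < r)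
    (hpu : ∀ k, ‖p‖ < ‖u k‖ * r) (hu1 : ∀ k, ‖u k‖ * r < 1) :
    (1 - (∏ k, u k / v k)⁻¹) *
        circleAverage (fun z => ∏ k, theta p (v k * z) / theta p (u k * z)) 0 r =
      ∑ k, theta p (v k / u k) / qPoch p p ^ 3 *
        ∏ l ∈ Finset.univ.erase k, theta p (v l / u k) / theta p (u l / u k) := by
  have hu (k : κ) : u k ≠ 0 := by
    rintro h
    exact (norm_nonneg p).not_gt (by simpa [h] using hpu k)
  have hun (k : κ) := norm_pos_iff.mpr (hu k)
  have hsplit (z : ℂ) : ∏ k, theta p (v k * z) / theta p (u k * z) =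
      (∏ k, thetaRegular p (v k) (u k) z) * ∏ k, (1 - z / (u k)⁻¹)⁻¹ := by
    simp only [theta_div_theta hp, div_inv_eq_mul, mul_comm z, Finset.prod_mul_distrib]
  have hinner (k : κ) : r < ‖(u k)⁻¹‖ := by
    rw [norm_inv, ← one_div, lt_div_iff₀' (hun k)]
    exact hu1 k
  have houter (k : κ) : ‖(u k)⁻¹‖ < ‖p⁻¹‖ * r := by
    have hk := hpu k
    have hpn := norm_pos_iff.mpr hp0
    rw [norm_inv, norm_inv, inv_mul_eq_div, lt_div_iff₀ hpn, inv_mul_lt_iff₀ (hun k)]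
    exact hk
  have hresidues := circleAverage_sub_circleAverage_of_poles
    (fun z => differentiableAt_prod_thetaRegular (v := v) hp hp0 hpu hu1) hr
    (inv_injective.comp hinj) hinner houter
  simp only [Function.comp_apply, ← hsplit,
    circleAverage_prod_theta_inv_mul hp hp0 hv hu hr] at hresidues
  rw [sub_mul, one_mul, hresidues]
  refine Finset.sum_congr rfl fun k _ => ?_
  rw [← Finset.mul_prod_erase _ _ (Finset.mem_univ k), thetaRegular_inv hp _ (hu k), mul_left_comm,
    ← Finset.prod_mul_distrib]
  congr 1
  refine Finset.prod_congr rfl fun l _ => ?_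
  rw [div_inv_eq_mul, div_eq_mul_inv (v l), div_eq_mul_inv (u l), theta_div_theta hp,
    mul_comm (u k)⁻¹, mul_comm]

end ThetaRatios

section ConstantTerm

open Metric Real

variable {M N : ℕ} {t p : ℂ} {x : Fin M → ℂ} {y : Fin N → ℂ} {r : ℝ}

/-- The inverses of the poles of `thetaRatio` modulo multiplication by powers of `p`. -/
noncomputable def poleInv (t : ℂ) (x : Fin M → ℂ) (y : Fin N → ℂ) : Fin M ⊕ Fin N → ℂ :=
  Sum.elim x fun j => t⁻¹ * (y j)⁻¹

/-- The inverses of the zeros of `thetaRatio` modulo multiplication by powers of `p`. -/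
noncomputable def zeroInv (t : ℂ) (x : Fin M → ℂ) (y : Fin N → ℂ) : Fin M ⊕ Fin N → ℂ :=
  Sum.elim (fun i => t⁻¹ * x i) fun j => (y j)⁻¹

/-- The circle of radius `r` lies in the annulus on which `thetaRatio` is expanded. -/
def IsExpansionRadius (t p : ℂ) (x : Fin M → ℂ) (y : Fin N → ℂ) (r : ℝ) : Prop :=
  0 < r ∧ ∀ k, ‖p‖ < ‖poleInv t x y k‖ * r ∧ ‖poleInv t x y k‖ * r < 1

lemma thetaRatio_eq_prod (t p : ℂ) (x : Fin M → ℂ) (y : Fin N → ℂ) :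
    thetaRatio M N t p x y =
      fun z => ∏ k, theta p (zeroInv t x y k * z) / theta p (poleInv t x y k * z) := by
  ext z
  have hy (j : Fin N) : z / y j = (y j)⁻¹ * z ∧ t⁻¹ * z / y j = t⁻¹ * (y j)⁻¹ * z := by
    constructor <;> ring
  simp only [thetaRatio, Fintype.prod_sum_type, zeroInv, poleInv, Sum.elim_inl, Sum.elim_inr, hy]

lemma expansionDomain_eq (t p : ℂ) (x : Fin M → ℂ) (y : Fin N → ℂ) :
    expansionDomain M N t p x y =
      {z | ∀ k, ‖p‖ < ‖poleInv t x y k * z‖ ∧ ‖poleInv t x y k * z‖ < 1} := by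
  ext z
  have hy (j : Fin N) : t⁻¹ * z / y j = t⁻¹ * (y j)⁻¹ * z := by ring
  simp only [expansionDomain, Set.mem_ofPred_eq, Sum.forall, poleInv, Sum.elim_inl, Sum.elim_inr,
    hy]

lemma poleInv_ne_zero (ht : t ≠ 0) (hx : ∀ i, x i ≠ 0) (hy : ∀ j, y j ≠ 0) (k : Fin M ⊕ Fin N) :
    poleInv t x y k ≠ 0 := by
  rcases k with i | j
  · exact hx i
  · exact mul_ne_zero (inv_ne_zero ht) (inv_ne_zero (hy j))

lemma zeroInv_ne_zero (ht : t ≠ 0) (hx : ∀ i, x i ≠ 0) (hy : ∀ j, y j ≠ 0) (k : Fin M ⊕ Fin N) :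
    zeroInv t x y k ≠ 0 := by
  rcases k with i | j
  · exact mul_ne_zero (inv_ne_zero ht) (hx i)
  · exact inv_ne_zero (hy j)

lemma poleInv_injective (ht : t ≠ 0) (hy : ∀ j, y j ≠ 0) (hxi : Function.Injective x)
    (hyi : Function.Injective y) (hxy : ∀ i j, t * x i * y j ≠ 1) :
    Function.Injective (poleInv t x y) := by
  refine hxi.sumElim (fun j j' h => hyi (inv_injective (mul_left_cancel₀ (inv_ne_zero ht) h)))
    fun i j h => hxy i j ?_
  have hyj := hy j
  rw [h]
  field_simp

lemma prod_poleInv_div_zeroInv (ht : t ≠ 0) (hx : ∀ i, x i ≠ 0) (hy : ∀ j, y j ≠ 0) :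
    ∏ k, poleInv t x y k / zeroInv t x y k = t ^ ((M : ℤ) - (N : ℤ)) := by
  have hinl (i : Fin M) : x i / (t⁻¹ * x i) = t := by
    have := hx i
    field_simp
  have hinr (j : Fin N) : t⁻¹ * (y j)⁻¹ / (y j)⁻¹ = t⁻¹ :=
    mul_div_cancel_right₀ _ (inv_ne_zero (hy j))
  simp only [Fintype.prod_sum_type, zeroInv, poleInv, Sum.elim_inl, Sum.elim_inr, hinl, hinr,
    Finset.prod_const, Finset.card_univ, Fintype.card_fin]
  rw [zpow_sub₀ ht, zpow_natCast, zpow_natCast, inv_pow, div_eq_mul_inv]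

lemma IsExpansionRadius.sphere_subset (hr : IsExpansionRadius t p x y r) :
    sphere 0 r ⊆ expansionDomain M N t p x y := fun z hz => by
  simpa only [expansionDomain_eq, Set.mem_ofPred_eq, norm_mul, mem_sphere_zero_iff_norm.mp hz]
    using hr.2

lemma IsExpansionRadius.poleInv_ne_zero (hr : IsExpansionRadius t p x y r) (k : Fin M ⊕ Fin N) :
    poleInv t x y k ≠ 0 := fun h => by
  have hk := (hr.2 k).1
  rw [h, norm_zero, zero_mul] at hk
  exact hk.not_ge (norm_nonneg p)

lemma IsExpansionRadius.left_ne_zero (hr : IsExpansionRadius t p x y r) (i : Fin M) : x i ≠ 0 :=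
  hr.poleInv_ne_zero (Sum.inl i)

lemma IsExpansionRadius.right_ne_zero (hr : IsExpansionRadius t p x y r) (j : Fin N) : y j ≠ 0 :=
  inv_eq_zero.not.mp (right_ne_zero_of_mul (hr.poleInv_ne_zero (Sum.inr j)))

lemma IsExpansionRadius.norm_div_bounds (hr : IsExpansionRadius t p x y r)
    (k l : Fin M ⊕ Fin N) :
    ‖p‖ < ‖poleInv t x y k / poleInv t x y l‖ ∧
      ‖p‖ * ‖poleInv t x y k / poleInv t x y l‖ < 1 := by
  obtain ⟨hpk, hk1⟩ := hr.2 k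
  obtain ⟨hpl, hl1⟩ := hr.2 l
  have hpos : 0 < ‖poleInv t x y l‖ * r := (norm_nonneg _).trans_lt hpl
  rw [norm_div, ← mul_div_mul_right _ _ hr.1.ne', lt_div_iff₀ hpos, ← mul_div_assoc,
    div_lt_one hpos]
  exact ⟨(mul_le_of_le_one_right (norm_nonneg _) hl1.le).trans_lt hpk,
    (mul_le_of_le_one_right (norm_nonneg _) hk1.le).trans_lt hpl⟩

lemma poleInv_inl_div_poleInv_inr (t : ℂ) (x : Fin M → ℂ) (y : Fin N → ℂ) (i : Fin M)
    (j : Fin N) : poleInv t x y (Sum.inl i) / poleInv t x y (Sum.inr j) = t * x i * y j := by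
  rw [poleInv, Sum.elim_inl, Sum.elim_inr, ← mul_inv, div_inv_eq_mul]
  ring

lemma ne_zpow_of_norm {s : ℂ} (hp : ‖p‖ < 1) (hps : ‖p‖ < ‖s‖) (hps' : ‖p‖ * ‖s‖ < 1)
    (hs : s ≠ 1) (k : ℤ) : s ≠ p ^ k := by
  rintro rfl
  have hk0 : k ≠ 0 := by
    rintro rfl
    exact hs (zpow_zero p)
  rcases eq_or_ne p 0 with rfl | hp0
  · simp [zero_zpow k hk0] at hps
  · have hpos := norm_pos_iff.mpr hp0
    rw [norm_zpow] at hps hps'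
    have hlt : k < 1 := by
      rwa [← zpow_lt_zpow_iff_right_of_lt_one₀ hpos hp, zpow_one]
    have hgt : 0 < k + 1 := by
      rwa [← zpow_lt_zpow_iff_right_of_lt_one₀ hpos hp, zpow_zero, zpow_add_one₀ hpos.ne',
        mul_comm]
    omega

variable [Nonempty (Fin M ⊕ Fin N)]

lemma IsExpansionRadius.norm_lt_one (hr : IsExpansionRadius t p x y r) : ‖p‖ < 1 := by
  obtain ⟨k⟩ := ‹Nonempty (Fin M ⊕ Fin N)›
  exact (hr.2 k).1.trans (hr.2 k).2

lemma IsExpansionRadius.theta_div_ne_zero (hr : IsExpansionRadius t p x y r)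
    {k l : Fin M ⊕ Fin N} (hkl : poleInv t x y k ≠ poleInv t x y l) :
    theta p (poleInv t x y k / poleInv t x y l) ≠ 0 := by
  obtain ⟨hlow, hup⟩ := hr.norm_div_bounds k l
  refine theta_ne_zero hr.norm_lt_one
    (div_ne_zero (hr.poleInv_ne_zero k) (hr.poleInv_ne_zero l))
    (ne_zpow_of_norm hr.norm_lt_one hlow hup ?_)
  rwa [Ne, div_eq_one_iff_eq (hr.poleInv_ne_zero l)]

lemma exists_hasLaurentExpansionOn_thetaRatio (hp : ‖p‖ < 1) (t : ℂ) (x : Fin M → ℂ)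
    (y : Fin N → ℂ) :
    ∃ a, HasLaurentExpansionOn (thetaRatio M N t p x y) (expansionDomain M N t p x y) a := by
  rw [thetaRatio_eq_prod, expansionDomain_eq]
  exact exists_hasLaurentExpansionOn_prod_theta hp _ _

lemma ellC_eq_circleAverage (hr : IsExpansionRadius t p x y r) :
    ellC M N t p x y = circleAverage (thetaRatio M N t p x y) 0 r :=
  constantTerm_eq_circleAverage hr.1 hr.sphere_subset
    (exists_hasLaurentExpansionOn_thetaRatio hr.norm_lt_one t x y)

lemma exists_isExpansionRadius (hne : (expansionDomain M N t p x y).Nonempty) :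
    ∃ r, IsExpansionRadius t p x y r := by
  obtain ⟨z, hz⟩ := hne
  simp only [expansionDomain_eq, Set.mem_ofPred_eq, norm_mul] at hz
  obtain ⟨k⟩ := ‹Nonempty (Fin M ⊕ Fin N)›
  exact ⟨‖z‖, pos_of_mul_pos_right ((norm_nonneg p).trans_lt (hz k).1) (norm_nonneg _), hz⟩

end ConstantTerm

section GenericFunctionalEquation

variable {M N : ℕ} {q t p : ℂ} {x : Fin M → ℂ} {y : Fin N → ℂ} {r : ℝ}

lemma ellKernel_swap (M N : ℕ) (q t p : ℂ) (x : Fin M → ℂ) (y : Fin N → ℂ) :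
    ellKernel M N q t p x y = ellKernel N M q t p y x := by
  simp only [ellKernel, mul_assoc, mul_comm (x _)]
  exact Finset.prod_comm

lemma ellGamma_div_ellGamma_mul_left (hq0 : q ≠ 0) (hq : ‖q‖ < 1) (hp : ‖p‖ < 1)
    (hs : qPoch p s ≠ 0) (hts : theta p (t * s) ≠ 0) :
    ellGamma q p (q * s) / ellGamma q p (t * (q * s)) =
      ellGamma q p s / ellGamma q p (t * s) * (theta p s / theta p (t * s)) := by
  have hpp := qPoch_self_ne_zero hp
  rw [mul_left_comm t q s, ellGamma_mul_left hq0 hq hp hs, div_eq_mul_inv,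
    div_eq_mul_inv (ellGamma q p s),
    inv_ellGamma_mul_left (x := t * s) hq0 hq hp (right_ne_zero_of_mul hts)]
  field_simp

lemma qShift_ellKernel (hq0 : q ≠ 0) (hq : ‖q‖ < 1) (hp : ‖p‖ < 1) (i : Fin M)
    (hxy : ∀ j, qPoch p (x i * y j) ≠ 0) (htxy : ∀ j, theta p (t * x i * y j) ≠ 0) :
    qShift q i (fun x' => ellKernel M N q t p x' y) x =
      ellKernel M N q t p x y * ∏ j, theta p (x i * y j) / theta p (t * x i * y j) := by
  rw [qShift, ellKernel, ellKernel, ← Finset.mul_prod_erase _ _ (Finset.mem_univ i),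
    ← Finset.mul_prod_erase _ _ (Finset.mem_univ i), mul_right_comm, ← Finset.prod_mul_distrib]
  congr 1
  · refine Finset.prod_congr rfl fun j _ => ?_
    have hshift := ellGamma_div_ellGamma_mul_left hq0 hq hp (hxy j)
      (by simpa only [mul_assoc] using htxy j)
    simpa only [Function.update_self, mul_assoc] using hshift
  · refine Finset.prod_congr rfl fun i' hi' => ?_
    rw [Function.update_of_ne (Finset.ne_of_mem_erase hi')]

lemma ellMacdonald_ellKernel (hq0 : q ≠ 0) (hq : ‖q‖ < 1) (hp : ‖p‖ < 1)
    (hxy : ∀ i j, qPoch p (x i * y j) ≠ 0) (htxy : ∀ i j, theta p (t * x i * y j) ≠ 0) :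
    ellMacdonald M q t p (fun x' => ellKernel M N q t p x' y) x = ellKernel M N q t p x y *
      ∑ i, (∏ j ∈ Finset.univ.erase i, theta p (t * x i / x j) / theta p (x i / x j)) *
        ∏ j, theta p (x i * y j) / theta p (t * x i * y j) := by
  rw [ellMacdonald, Finset.mul_sum]
  refine Finset.sum_congr rfl fun i _ => ?_
  rw [qShift_ellKernel hq0 hq hp i (hxy i) (htxy i), mul_left_comm]

lemma theta_inv_div_theta_inv {a b : ℂ} (hp : ‖p‖ < 1) (ha : a ≠ 0) (hb : b ≠ 0) :
    theta p a⁻¹ / theta p b⁻¹ = b / a * (theta p a / theta p b) := by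
  rw [theta_inv hp ha, theta_inv hp hb]
  field_simp

-- The summand of `circleAverage_prod_theta` at the pole `(x i)⁻¹` is, up to a constant, the
-- `i`-th summand of `ellMacdonald_ellKernel`.
lemma residue_thetaRatio_inl (hp : ‖p‖ < 1) (ht : t ≠ 0) (hx : ∀ i, x i ≠ 0)
    (hy : ∀ j, y j ≠ 0) (i : Fin M) :
    theta p (zeroInv t x y (Sum.inl i) / poleInv t x y (Sum.inl i)) / qPoch p p ^ 3 *
        ∏ l ∈ Finset.univ.erase (Sum.inl i), theta p (zeroInv t x y l / poleInv t x y (Sum.inl i)) /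
          theta p (poleInv t x y l / poleInv t x y (Sum.inl i)) =
      -(t ^ ((M : ℤ) - (N : ℤ)))⁻¹ * (theta p t / qPoch p p ^ 3) *
        ((∏ j ∈ Finset.univ.erase i, theta p (t * x i / x j) / theta p (x i / x j)) *
          ∏ j, theta p (x i * y j) / theta p (t * x i * y j)) := by
  have hi := hx i
  have hinl (i' : Fin M) : theta p (t⁻¹ * x i' / x i) / theta p (x i' / x i) =
      t⁻¹ * (theta p (t * x i / x i') / theta p (x i / x i')) := by
    have hi' := hx i'
    convert! theta_inv_div_theta_inv hp (a := t * x i / x i') (b := x i / x i') (by positivity)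
      (by positivity) using 2 <;> field_simp
  have hinr (j : Fin N) : theta p ((y j)⁻¹ / x i) / theta p (t⁻¹ * (y j)⁻¹ / x i) =
      t * (theta p (x i * y j) / theta p (t * x i * y j)) := by
    have hj := hy j
    convert! theta_inv_div_theta_inv hp (a := x i * y j) (b := t * x i * y j) (by positivity)
      (by positivity) using 2 <;> field_simp
  have herase : (Finset.univ : Finset (Fin M ⊕ Fin N)).erase (Sum.inl i) =
      (Finset.univ.erase i).disjSum Finset.univ := by
    ext (k | k) <;> simp
  have hpow : t ^ M = t * t ^ (M - 1) := by rw [← pow_succ', Nat.sub_add_cancel i.pos]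
  rw [herase, Finset.prod_disjSum]
  simp only [zeroInv, poleInv, Sum.elim_inl, Sum.elim_inr, mul_div_cancel_right₀ _ hi, hinl, hinr,
    Finset.prod_mul_distrib, Finset.prod_const, Finset.card_univ, Fintype.card_fin,
    Finset.card_erase_of_mem (Finset.mem_univ i), theta_inv hp ht]
  rw [zpow_sub₀ ht, zpow_natCast, zpow_natCast, inv_div, hpow, inv_pow]
  field_simp

lemma residue_thetaRatio_inr (ht : t ≠ 0) (hy : ∀ j, y j ≠ 0) (j : Fin N) :
    theta p (zeroInv t x y (Sum.inr j) / poleInv t x y (Sum.inr j)) / qPoch p p ^ 3 *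
        ∏ l ∈ Finset.univ.erase (Sum.inr j), theta p (zeroInv t x y l / poleInv t x y (Sum.inr j)) /
          theta p (poleInv t x y l / poleInv t x y (Sum.inr j)) =
      theta p t / qPoch p p ^ 3 *
        ((∏ i ∈ Finset.univ.erase j, theta p (t * y j / y i) / theta p (y j / y i)) *
          ∏ i, theta p (y j * x i) / theta p (t * y j * x i)) := by
  have hj := hy j
  have hself : (y j)⁻¹ / (t⁻¹ * (y j)⁻¹) = t := by field_simp
  have hinl (i : Fin M) : t⁻¹ * x i / (t⁻¹ * (y j)⁻¹) = y j * x i ∧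
      x i / (t⁻¹ * (y j)⁻¹) = t * y j * x i := by
    constructor <;> field_simp
  have hinr (i : Fin N) : (y i)⁻¹ / (t⁻¹ * (y j)⁻¹) = t * y j / y i ∧
      t⁻¹ * (y i)⁻¹ / (t⁻¹ * (y j)⁻¹) = y j / y i := by
    have hi := hy i
    constructor <;> field_simp
  have herase : (Finset.univ : Finset (Fin M ⊕ Fin N)).erase (Sum.inr j) =
      Finset.univ.disjSum (Finset.univ.erase j) := by
    ext (k | k) <;> simp
  rw [herase, Finset.prod_disjSum, mul_comm (∏ i ∈ Finset.univ.erase j, _)]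
  simp only [zeroInv, poleInv, Sum.elim_inl, Sum.elim_inr, hself, hinl, hinr]

/-- The function `{H_M(q,t,p)_x - t^{M-N} H_N(q,t,p)_y} Π_{MN}(q,t,p)(x,y)`. -/
noncomputable def functionalEquationLeft (q t p : ℂ) (x : Fin M → ℂ) (y : Fin N → ℂ) : ℂ :=
  ellMacdonald M q t p (fun x' => ellKernel M N q t p x' y) x -
    t ^ ((M : ℤ) - (N : ℤ)) * ellMacdonald N q t p (fun y' => ellKernel M N q t p x y') y

/-- The function `(1 - t^{M-N}) (p;p)_∞³ / Θ_p(t) · C_{MN}(p;x,y) Π_{MN}(q,t,p)(x,y)`. -/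
noncomputable def functionalEquationRight (q t p : ℂ) (x : Fin M → ℂ) (y : Fin N → ℂ) : ℂ :=
  (1 - t ^ ((M : ℤ) - (N : ℤ))) * qPoch p p ^ 3 / theta p t * ellC M N t p x y *
    ellKernel M N q t p x y

variable [Nonempty (Fin M ⊕ Fin N)]

lemma functional_equation_of_generic (hq0 : q ≠ 0) (hq : ‖q‖ < 1) (ht : t ≠ 0) (hp0 : p ≠ 0)
    (htp : ∀ k : ℤ, t ≠ p ^ k) (hxi : Function.Injective x) (hyi : Function.Injective y)
    (hxy : ∀ i j, qPoch p (x i * y j) ≠ 0) (htxy : ∀ i j, t * x i * y j ≠ 1)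
    (hr : IsExpansionRadius t p x y r) :
    functionalEquationLeft q t p x y = functionalEquationRight q t p x y := by
  have hp := hr.norm_lt_one
  have hx := hr.left_ne_zero
  have hy := hr.right_ne_zero
  have hinj := poleInv_injective ht hy hxi hyi htxy
  have hpole (i : Fin M) (j : Fin N) : theta p (t * x i * y j) ≠ 0 :=
    poleInv_inl_div_poleInv_inr t x y i j ▸ hr.theta_div_ne_zero (hinj.ne Sum.inl_ne_inr)
  have hresidues := circleAverage_prod_theta hp hp0 (zeroInv_ne_zero ht hx hy) hinj hr.1
    (fun k => (hr.2 k).1) (fun k => (hr.2 k).2)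
  simp only [← thetaRatio_eq_prod, ← ellC_eq_circleAverage hr, Fintype.sum_sum_type,
    prod_poleInv_div_zeroInv ht hx hy, residue_thetaRatio_inl hp ht hx hy,
    residue_thetaRatio_inr ht hy, ← Finset.mul_sum] at hresidues
  have hHx := ellMacdonald_ellKernel hq0 hq hp hxy hpole
  have hHy := ellMacdonald_ellKernel hq0 hq hp (fun j i => by rw [mul_comm]; exact hxy i j)
    (fun j i => by rw [mul_right_comm]; exact hpole i j)
  simp only [ellKernel_swap N M] at hHy
  rw [functionalEquationLeft, functionalEquationRight, hHx, hHy]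
  have hl := zpow_ne_zero ((M : ℤ) - (N : ℤ)) ht
  have hpp := qPoch_self_ne_zero hp
  have hθ := theta_ne_zero hp ht htp
  generalize t ^ ((M : ℤ) - (N : ℤ)) = l at hresidues hl ⊢
  have hconst : (1 - l) * ellC M N t p x y = -l * ((1 - l⁻¹) * ellC M N t p x y) := by
    field_simp
    ring
  rw [mul_div_assoc, mul_right_comm (1 - l), hconst, hresidues]
  field_simp
  ring

end GenericFunctionalEquation

section Continuity

open Metric Real

lemma continuousOn_circleAverage {X E : Type*} [TopologicalSpace X] [NormedAddCommGroup E]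
    [NormedSpace ℝ E] {f : X → ℂ → E} {s : Set X} {c : ℂ} {r : ℝ}
    (hf : ContinuousOn (Function.uncurry f) (s ×ˢ sphere c |r|)) :
    ContinuousOn (fun a => circleAverage (f a) c r) s := by
  rw [continuousOn_iff_continuous_domRestrict]
  refine .const_smul
    (intervalIntegral.continuous_parametric_intervalIntegral_of_continuous' ?_ _ _) _
  exact hf.comp_continuous
    ((continuous_subtype_val.comp continuous_fst).prodMk
      ((continuous_circleMap c r).comp continuous_snd))
    fun a => ⟨a.1.2, circleMap_mem_sphere' c r a.2⟩

variable {M N : ℕ} {q t p : ℂ} {x : Fin M → ℂ} {y : Fin N → ℂ} {r : ℝ}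

lemma continuousAt_poleInv (t : ℂ) (x : Fin M → ℂ) (hy : ∀ j, y j ≠ 0) :
    ContinuousAt (fun w : (Fin M → ℂ) × (Fin N → ℂ) => poleInv t w.1 w.2) (x, y) := by
  refine continuousAt_pi.mpr fun k => ?_
  rcases k with i | j
  · exact ((continuous_apply i).comp continuous_fst).continuousAt
  · exact (ContinuousAt.inv₀ (f := fun w : (Fin M → ℂ) × (Fin N → ℂ) => w.2 j) (by fun_prop)
      (hy j)).const_mul _

lemma continuousAt_zeroInv (t : ℂ) (x : Fin M → ℂ) (hy : ∀ j, y j ≠ 0) :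
    ContinuousAt (fun w : (Fin M → ℂ) × (Fin N → ℂ) => zeroInv t w.1 w.2) (x, y) := by
  refine continuousAt_pi.mpr fun k => ?_
  rcases k with i | j
  · exact ((continuous_apply i).comp continuous_fst).continuousAt.const_mul _
  · exact ContinuousAt.inv₀ (f := fun w : (Fin M → ℂ) × (Fin N → ℂ) => w.2 j) (by fun_prop) (hy j)

lemma IsExpansionRadius.eventually (hr : IsExpansionRadius t p x y r) :
    ∀ᶠ w : ℂ × (Fin M → ℂ) × (Fin N → ℂ) in 𝓝 (p, x, y),
      IsExpansionRadius t w.1 w.2.1 w.2.2 r := by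
  have hp : Tendsto (fun w : ℂ × (Fin M → ℂ) × (Fin N → ℂ) => ‖w.1‖) (𝓝 (p, x, y)) (𝓝 ‖p‖) :=
    continuous_fst.norm.continuousAt
  have hu (k : Fin M ⊕ Fin N) : Tendsto (fun w : ℂ × (Fin M → ℂ) × (Fin N → ℂ) =>
      ‖poleInv t w.2.1 w.2.2 k‖ * r) (𝓝 (p, x, y)) (𝓝 (‖poleInv t x y k‖ * r)) := by
    have hpole := ((continuousAt_poleInv t x hr.right_ne_zero).comp_of_eq
      (continuous_snd.continuousAt (x := (p, x, y))) rfl)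
    exact ((continuousAt_pi.mp hpole k).norm.mul_const r)
  refine (eventually_all.mpr fun k => ?_).mono fun w hw => ⟨hr.1, hw⟩
  exact (hp.eventually_lt (hu k) (hr.2 k).1).and ((hu k).eventually_lt_const (hr.2 k).2)

lemma continuousOn_thetaRatio (ht : t ≠ 0) :
    ContinuousOn (fun w : (ℂ × (Fin M → ℂ) × (Fin N → ℂ)) × ℂ =>
      thetaRatio M N t w.1.1 w.1.2.1 w.1.2.2 w.2)
      ({w | IsExpansionRadius t w.1 w.2.1 w.2.2 r} ×ˢ sphere 0 |r|) := by
  rintro ⟨⟨p, x, y⟩, z⟩ ⟨hr, hz⟩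
  have hr : IsExpansionRadius t p x y r := hr
  have hzr : ‖z‖ = r := by simpa [abs_of_pos hr.1] using hz
  have hz0 : z ≠ 0 := norm_pos_iff.mp (hzr ▸ hr.1)
  refine ContinuousAt.continuousWithinAt ?_
  simp only [thetaRatio_eq_prod]
  refine tendsto_finsetProd _ fun k _ => ?_
  have hparam : ContinuousAt (fun w : (ℂ × (Fin M → ℂ) × (Fin N → ℂ)) × ℂ => w.1.2)
    ((p, x, y), z) := by fun_prop
  have hu := continuousAt_pi.mp
    ((continuousAt_poleInv t x hr.right_ne_zero).comp_of_eq hparam rfl) k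
  have hv := continuousAt_pi.mp
    ((continuousAt_zeroInv t x hr.right_ne_zero).comp_of_eq hparam rfl) k
  have hpk : ‖p‖ < ‖poleInv t x y k * z‖ := by rw [norm_mul, hzr]; exact (hr.2 k).1
  have hk1 : ‖poleInv t x y k * z‖ < 1 := by rw [norm_mul, hzr]; exact (hr.2 k).2
  have hp : ‖p‖ < 1 := hpk.trans hk1
  have hpl : ContinuousAt (fun w : (ℂ × (Fin M → ℂ) × (Fin N → ℂ)) × ℂ => w.1.1)
    ((p, x, y), z) := by fun_prop
  exact (tendsto_theta hp
    (mul_ne_zero (zeroInv_ne_zero ht hr.left_ne_zero hr.right_ne_zero k) hz0) hpl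
    (hv.tendsto.mul continuousAt_snd)).div
    (tendsto_theta hp (mul_ne_zero (hr.poleInv_ne_zero k) hz0) hpl
      (hu.tendsto.mul continuousAt_snd)) (theta_ne_zero_of_norm hpk hk1)

lemma continuousAt_ellC [Nonempty (Fin M ⊕ Fin N)] (ht : t ≠ 0)
    (hr : IsExpansionRadius t p x y r) :
    ContinuousAt (fun w : ℂ × (Fin M → ℂ) × (Fin N → ℂ) => ellC M N t w.1 w.2.1 w.2.2)
      (p, x, y) :=
  ((continuousOn_circleAverage (continuousOn_thetaRatio ht)).congr fun _ hw =>
    ellC_eq_circleAverage hw).continuousAt hr.eventually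

lemma continuousAt_ellKernel (hq : ‖q‖ < 1) (ht : t ≠ 0) (hp : ‖p‖ < 1) (hx : ∀ i, x i ≠ 0)
    (hy : ∀ j, y j ≠ 0) (hxy : ∀ i j, qpPoch q p (x i * y j) ≠ 0)
    (htxy : ∀ i j, ‖q * p‖ < ‖t * x i * y j‖) :
    ContinuousAt (fun w : ℂ × (Fin M → ℂ) × (Fin N → ℂ) => ellKernel M N q t w.1 w.2.1 w.2.2)
      (p, x, y) := by
  simp only [ellKernel, div_eq_mul_inv]
  refine tendsto_finsetProd _ fun i _ => tendsto_finsetProd _ fun j _ => ?_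
  have hne := mul_ne_zero (mul_ne_zero ht (hx i)) (hy j)
  have hnum : ‖q * p * (t * x i * y j)⁻¹‖ < 1 := by
    rw [norm_mul, norm_inv, ← div_eq_mul_inv, div_lt_one (norm_pos_iff.mpr hne)]
    exact htxy i j
  have hpl : ContinuousAt (fun w : ℂ × (Fin M → ℂ) × (Fin N → ℂ) => w.1) (p, x, y) := by fun_prop
  have hxyl : ContinuousAt (fun w : ℂ × (Fin M → ℂ) × (Fin N → ℂ) => w.2.1 i * w.2.2 j)
    (p, x, y) := by fun_prop
  have htxyl : ContinuousAt (fun w : ℂ × (Fin M → ℂ) × (Fin N → ℂ) => t * w.2.1 i * w.2.2 j)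
    (p, x, y) := by fun_prop
  exact (tendsto_ellGamma hq hp (mul_ne_zero (hx i) (hy j)) (hxy i j) hpl hxyl).mul
    (tendsto_inv_ellGamma hq hp hne (qpPoch_ne_zero_of_norm_lt_one hq hp hnum) hpl htxyl)

lemma continuousAt_qShift_ellKernel (hq0 : q ≠ 0) (hq : ‖q‖ < 1) (ht : t ≠ 0) (hp : ‖p‖ < 1)
    (hx : ∀ i, x i ≠ 0) (hy : ∀ j, y j ≠ 0) (hxy : ∀ i j, qpPoch q p (x i * y j) ≠ 0)
    (htxy : ∀ i j, ‖p‖ < ‖t * x i * y j‖) (i : Fin M) :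
    ContinuousAt (fun w : ℂ × (Fin M → ℂ) × (Fin N → ℂ) =>
      qShift q i (fun x' => ellKernel M N q t w.1 x' w.2.2) w.2.1) (p, x, y) := by
  have hx' (i' : Fin M) : Function.update x i (q * x i) i' ≠ 0 := by
    rcases eq_or_ne i' i with rfl | hi
    · simpa only [Function.update_self] using mul_ne_zero hq0 (hx i')
    · simpa only [Function.update_of_ne hi] using hx i'
  have hxy' (i' : Fin M) (j : Fin N) :
      qpPoch q p (Function.update x i (q * x i) i' * y j) ≠ 0 := by
    rcases eq_or_ne i' i with rfl | hi
    · have hfactor := hxy i' j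
      rw [qpPoch_eq_qPoch_mul hq hp, ← mul_assoc] at hfactor
      simpa only [Function.update_self] using right_ne_zero_of_mul hfactor
    · simpa only [Function.update_of_ne hi] using hxy i' j
  have htxy' (i' : Fin M) (j : Fin N) :
      ‖q * p‖ < ‖t * Function.update x i (q * x i) i' * y j‖ := by
    rcases eq_or_ne i' i with rfl | hi
    · rw [Function.update_self, mul_left_comm, mul_assoc q, norm_mul, norm_mul q]
      exact mul_lt_mul_of_pos_left (htxy i' j) (norm_pos_iff.mpr hq0)
    · rw [Function.update_of_ne hi, norm_mul]
      exact (mul_le_of_le_one_left (norm_nonneg p) hq.le).trans_lt (htxy i' j)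
  have hshift : ContinuousAt (fun w : ℂ × (Fin M → ℂ) × (Fin N → ℂ) =>
      (w.1, Function.update w.2.1 i (q * w.2.1 i), w.2.2)) (p, x, y) := by fun_prop
  have hkernel := continuousAt_ellKernel hq ht hp hx' hy hxy' htxy'
  exact hkernel.comp (f := fun w : ℂ × (Fin M → ℂ) × (Fin N → ℂ) =>
    (w.1, Function.update w.2.1 i (q * w.2.1 i), w.2.2)) (x := (p, x, y)) hshift

lemma continuousAt_ellMacdonald_ellKernel (hq0 : q ≠ 0) (hq : ‖q‖ < 1) (ht : t ≠ 0)
    (hp : ‖p‖ < 1) (hx : ∀ i, x i ≠ 0) (hy : ∀ j, y j ≠ 0)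
    (hxy : ∀ i j, qpPoch q p (x i * y j) ≠ 0) (htxy : ∀ i j, ‖p‖ < ‖t * x i * y j‖)
    (hxx : ∀ i j, j ≠ i → theta p (x i / x j) ≠ 0) :
    ContinuousAt (fun w : ℂ × (Fin M → ℂ) × (Fin N → ℂ) =>
      ellMacdonald M q t w.1 (fun x' => ellKernel M N q t w.1 x' w.2.2) w.2.1) (p, x, y) := by
  refine tendsto_finsetSum _ fun i _ => (tendsto_finsetProd _ fun j hj => ?_).mul
    (continuousAt_qShift_ellKernel hq0 hq ht hp hx hy hxy htxy i)
  have hpl : ContinuousAt (fun w : ℂ × (Fin M → ℂ) × (Fin N → ℂ) => w.1) (p, x, y) := by fun_prop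
  have hxl (k : Fin M) : ContinuousAt (fun w : ℂ × (Fin M → ℂ) × (Fin N → ℂ) => w.2.1 k)
    (p, x, y) := by fun_prop
  exact (tendsto_theta hp (div_ne_zero (mul_ne_zero ht (hx i)) (hx j)) hpl
    (((hxl i).tendsto.const_mul t).div (hxl j) (hx j))).div
    (tendsto_theta hp (div_ne_zero (hx i) (hx j)) hpl ((hxl i).tendsto.div (hxl j) (hx j)))
    (hxx i j (Finset.ne_of_mem_erase hj))

variable [Nonempty (Fin M ⊕ Fin N)]

lemma continuousAt_functionalEquationLeft (hq0 : q ≠ 0) (hq : ‖q‖ < 1) (ht : t ≠ 0)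
    (hxi : Function.Injective x) (hyi : Function.Injective y)
    (hxy : ∀ i j, qpPoch q p (x i * y j) ≠ 0) (hr : IsExpansionRadius t p x y r) :
    ContinuousAt (fun w : ℂ × (Fin M → ℂ) × (Fin N → ℂ) =>
      functionalEquationLeft q t w.1 w.2.1 w.2.2) (p, x, y) := by
  have hp := hr.norm_lt_one
  have hx := hr.left_ne_zero
  have hy := hr.right_ne_zero
  have htxy (i : Fin M) (j : Fin N) : ‖p‖ < ‖t * x i * y j‖ :=
    poleInv_inl_div_poleInv_inr t x y i j ▸ (hr.norm_div_bounds _ _).1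
  have hxx (i j : Fin M) (hij : j ≠ i) : theta p (x i / x j) ≠ 0 :=
    hr.theta_div_ne_zero (k := Sum.inl i) (l := Sum.inl j) (hxi.ne hij.symm)
  have hyy (i j : Fin N) (hij : j ≠ i) : theta p (y i / y j) ≠ 0 := by
    have hquot : y i / y j = poleInv t x y (Sum.inr j) / poleInv t x y (Sum.inr i) := by
      simp only [poleInv, Sum.elim_inr, mul_div_mul_left _ _ (inv_ne_zero ht), inv_div_inv]
    rw [hquot]
    refine hr.theta_div_ne_zero fun h => hyi.ne hij (inv_injective ?_)
    exact mul_left_cancel₀ (inv_ne_zero ht) h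
  have hswap : ContinuousAt (fun w : ℂ × (Fin M → ℂ) × (Fin N → ℂ) => (w.1, w.2.2, w.2.1))
    (p, x, y) := by fun_prop
  have hHy := (continuousAt_ellMacdonald_ellKernel hq0 hq ht hp hy hx
    (fun j i => mul_comm (x i) (y j) ▸ hxy i j)
    (fun j i => mul_right_comm t (x i) (y j) ▸ htxy i j) hyy).comp_of_eq hswap rfl
  simp only [Function.comp_def, ellKernel_swap N M] at hHy
  exact (continuousAt_ellMacdonald_ellKernel hq0 hq ht hp hx hy hxy htxy hxx).tendsto.sub
    (hHy.tendsto.const_mul _)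

lemma continuousAt_functionalEquationRight (hq : ‖q‖ < 1) (ht : t ≠ 0)
    (htp : ∀ k : ℤ, t ≠ p ^ k) (hxy : ∀ i j, qpPoch q p (x i * y j) ≠ 0)
    (hr : IsExpansionRadius t p x y r) :
    ContinuousAt (fun w : ℂ × (Fin M → ℂ) × (Fin N → ℂ) =>
      functionalEquationRight q t w.1 w.2.1 w.2.2) (p, x, y) := by
  have hp := hr.norm_lt_one
  have htxy (i : Fin M) (j : Fin N) : ‖q * p‖ < ‖t * x i * y j‖ := by
    rw [norm_mul, ← poleInv_inl_div_poleInv_inr t x y i j]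
    exact (mul_le_of_le_one_left (norm_nonneg p) hq.le).trans_lt (hr.norm_div_bounds _ _).1
  have hpl : ContinuousAt (fun w : ℂ × (Fin M → ℂ) × (Fin N → ℂ) => w.1) (p, x, y) := by fun_prop
  exact (((((tendsto_qPoch hp hpl hpl).pow 3).const_mul _).div
    (tendsto_theta hp ht hpl tendsto_const_nhds) (theta_ne_zero hp ht htp)).mul
    (continuousAt_ellC ht hr)).mul
    (continuousAt_ellKernel hq ht hp hr.left_ne_zero hr.right_ne_zero hxy htxy)

end Continuity

section FunctionalEquation

open Metric Real

variable {M N : ℕ} {q t p : ℂ} {x : Fin M → ℂ} {y : Fin N → ℂ} {r : ℝ}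

lemma eventually_forall_ne_zpow (ht : t ≠ 0) (ht1 : t ≠ 1) :
    ∀ᶠ p : ℂ in 𝓝 0, ∀ k : ℤ, t ≠ p ^ k := by
  have hnorm : Tendsto (fun p : ℂ => ‖p‖) (𝓝 0) (𝓝 0) := tendsto_norm_zero
  have hmul : Tendsto (fun p : ℂ => ‖p‖ * ‖t‖) (𝓝 0) (𝓝 0) := by simpa using hnorm.mul_const ‖t‖
  filter_upwards [hnorm.eventually_lt_const one_pos,
    hnorm.eventually_lt_const (norm_pos_iff.mpr ht), hmul.eventually_lt_const one_pos]
    with p hp hpt hpt' using ne_zpow_of_norm hp hpt hpt' ht1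

lemma exists_isExpansionRadius_zero (ht : t ≠ 0) (hx : ∀ i, x i ≠ 0) (hy : ∀ j, y j ≠ 0) :
    ∃ r, IsExpansionRadius t 0 x y r := by
  have hpos : 0 < 1 + ∑ k, ‖poleInv t x y k‖ :=
    add_pos_of_pos_of_nonneg one_pos (Finset.sum_nonneg fun _ _ => norm_nonneg _)
  refine ⟨1 / (1 + ∑ k, ‖poleInv t x y k‖), one_div_pos.mpr hpos, fun k => ⟨?_, ?_⟩⟩
  · have hk := norm_pos_iff.mpr (poleInv_ne_zero ht hx hy k)
    rw [norm_zero]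
    exact mul_pos hk (one_div_pos.mpr hpos)
  · have hle : ‖poleInv t x y k‖ ≤ ∑ k, ‖poleInv t x y k‖ :=
      Finset.single_le_sum (f := fun k => ‖poleInv t x y k‖) (fun _ _ => norm_nonneg _)
        (Finset.mem_univ k)
    rw [mul_one_div, div_lt_one hpos]
    linarith

variable [Nonempty (Fin M ⊕ Fin N)]

lemma functional_equation_of_tendsto {ι : Type*} {l : Filter ι} [l.NeBot]
    {w : ι → ℂ × (Fin M → ℂ) × (Fin N → ℂ)} (hq0 : q ≠ 0) (hq : ‖q‖ < 1) (ht : t ≠ 0)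
    (htp : ∀ k : ℤ, t ≠ p ^ k) (hxi : Function.Injective x) (hyi : Function.Injective y)
    (hxy : ∀ i j, qpPoch q p (x i * y j) ≠ 0) (hr : IsExpansionRadius t p x y r)
    (hw : Tendsto w l (𝓝 (p, x, y)))
    (heq : ∀ᶠ s in l, functionalEquationLeft q t (w s).1 (w s).2.1 (w s).2.2 =
      functionalEquationRight q t (w s).1 (w s).2.1 (w s).2.2) :
    functionalEquationLeft q t p x y = functionalEquationRight q t p x y :=
  tendsto_nhds_unique_of_eventuallyEq
    ((continuousAt_functionalEquationLeft hq0 hq ht hxi hyi hxy hr).tendsto.comp hw)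
    ((continuousAt_functionalEquationRight hq ht htp hxy hr).tendsto.comp hw) heq

-- Rescaling `y` by `s → 1` separates the poles of the theta ratio.
lemma functional_equation_of_ne_zero (hq0 : q ≠ 0) (hq : ‖q‖ < 1) (ht : t ≠ 0) (hp0 : p ≠ 0)
    (htp : ∀ k : ℤ, t ≠ p ^ k) (hxi : Function.Injective x) (hyi : Function.Injective y)
    (hxy : ∀ i j, qpPoch q p (x i * y j) ≠ 0) (hr : IsExpansionRadius t p x y r) :
    functionalEquationLeft q t p x y = functionalEquationRight q t p x y := by
  have hs : Tendsto (fun s : ℂ => s) (𝓝[≠] 1) (𝓝 1) := nhdsWithin_le_nhds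
  have hw : Tendsto (fun s : ℂ => (p, x, s • y)) (𝓝[≠] 1) (𝓝 (p, x, y)) := by
    simpa only [one_smul] using
      tendsto_const_nhds.prodMk_nhds (tendsto_const_nhds.prodMk_nhds (hs.smul_const y))
  refine functional_equation_of_tendsto hq0 hq ht htp hxi hyi hxy hr hw ?_
  have hsy (j : Fin N) : Tendsto (fun s : ℂ => s * y j) (𝓝[≠] 1) (𝓝 (y j)) := by
    simpa using hs.mul_const (y j)
  have hxys : ∀ᶠ s : ℂ in 𝓝[≠] 1, ∀ i j, qPoch p (x i * (s * y j)) ≠ 0 :=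
    eventually_all.mpr fun i => eventually_all.mpr fun j =>
      (tendsto_qPoch hr.norm_lt_one tendsto_const_nhds
        ((hsy j).const_mul (x i))).eventually_ne
        (left_ne_zero_of_mul (qpPoch_eq_qPoch_mul hq hr.norm_lt_one (x i * y j) ▸ hxy i j))
  have htxys : ∀ᶠ s : ℂ in 𝓝[≠] 1, ∀ i j, t * x i * (s * y j) ≠ 1 := by
    refine eventually_all.mpr fun i => eventually_all.mpr fun j => ?_
    by_cases h : t * x i * y j = 1
    · filter_upwards [self_mem_nhdsWithin] with s hs1
      rwa [mul_left_comm, h, mul_one]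
    · exact ((hsy j).const_mul (t * x i)).eventually_ne h
  filter_upwards [hs.eventually_ne one_ne_zero, hxys, htxys, hw.eventually hr.eventually]
    with s hs0 hxys htxys hrs
  exact functional_equation_of_generic hq0 hq ht hp0 htp hxi
    (fun j j' h => hyi (mul_left_cancel₀ hs0 h)) hxys htxys hrs

lemma functional_equation_zero (hq0 : q ≠ 0) (hq : ‖q‖ < 1) (ht : t ≠ 0) (ht1 : t ≠ 1)
    (hxi : Function.Injective x) (hyi : Function.Injective y)
    (hxy : ∀ i j, qpPoch q 0 (x i * y j) ≠ 0) (hr : IsExpansionRadius t 0 x y r) :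
    functionalEquationLeft q t 0 x y = functionalEquationRight q t 0 x y := by
  have hp : Tendsto (fun p : ℂ => p) (𝓝[≠] 0) (𝓝 0) := nhdsWithin_le_nhds
  have hw : Tendsto (fun p : ℂ => (p, x, y)) (𝓝[≠] 0) (𝓝 (0, x, y)) :=
    hp.prodMk_nhds tendsto_const_nhds
  have htp := eventually_forall_ne_zpow ht ht1
  refine functional_equation_of_tendsto hq0 hq ht htp.self_of_nhds hxi hyi hxy hr hw ?_
  have hxyp : ∀ᶠ p : ℂ in 𝓝[≠] 0, ∀ i j, qpPoch q p (x i * y j) ≠ 0 :=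
    eventually_all.mpr fun i => eventually_all.mpr fun j =>
      (tendsto_qpPoch hq hr.norm_lt_one hp tendsto_const_nhds).eventually_ne (hxy i j)
  filter_upwards [self_mem_nhdsWithin, hp.eventually htp, hxyp, hw.eventually hr.eventually]
    with p hp0 htp hxyp hrp
  exact functional_equation_of_ne_zero hq0 hq ht hp0 htp hxi hyi hxyp hrp

theorem functional_equation (hq0 : q ≠ 0) (hq : ‖q‖ < 1) (ht : t ≠ 0) (hp : ‖p‖ < 1)
    (htp : ∀ k : ℤ, t ≠ p ^ k) (hxi : Function.Injective x) (hyi : Function.Injective y)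
    (hxy : ∀ i j, ∀ m n : ℕ, x i * y j * q ^ m * p ^ n ≠ 1)
    (hne : (expansionDomain M N t p x y).Nonempty) :
    functionalEquationLeft q t p x y = functionalEquationRight q t p x y := by
  obtain ⟨r, hr⟩ := exists_isExpansionRadius hne
  have hxy' (i : Fin M) (j : Fin N) := qpPoch_ne_zero hq hp (hxy i j)
  rcases eq_or_ne p 0 with rfl | hp0
  · exact functional_equation_zero hq0 hq ht (by simpa using htp 0) hxi hyi hxy' hr
  · exact functional_equation_of_ne_zero hq0 hq ht hp0 htp hxi hyi hxy' hr

end FunctionalEquation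

section TrigonometricLimit

open Metric Real

variable {M N : ℕ} {q t : ℂ} {x : Fin M → ℂ} {y : Fin N → ℂ} {r : ℝ}

lemma ellKernel_zero (q t : ℂ) (x : Fin M → ℂ) (y : Fin N → ℂ) :
    ellKernel M N q t 0 x y = trigKernel M N q t x y := by
  simp only [ellKernel, trigKernel, ellGamma_zero_middle, inv_div_inv]

lemma ellMacdonald_zero (q t : ℂ) (f : (Fin M → ℂ) → ℂ) (hx : ∀ i, x i ≠ 0) :
    ellMacdonald M q t 0 f x = trigMacdonald M q t f x := by
  refine Finset.sum_congr rfl fun i _ => ?_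
  congr 1
  refine Finset.prod_congr rfl fun j _ => ?_
  have hj := hx j
  rw [theta_zero_left, theta_zero_left, one_sub_div hj, one_sub_div hj,
    div_div_div_cancel_right₀ hj, ← neg_sub (t * x i), ← neg_sub (x i), neg_div_neg_eq]

variable [Nonempty (Fin M ⊕ Fin N)]

-- At `p = 0` the theta ratio is holomorphic on the disc bounded by the circle of integration.
lemma ellC_zero (hr : IsExpansionRadius t 0 x y r) : ellC M N t 0 x y = 1 := by
  rw [ellC_eq_circleAverage hr, thetaRatio_eq_prod]
  simp only [theta_zero_left]
  have hdiff (z : ℂ) (hz : z ∈ closedBall (0 : ℂ) |r|) : DifferentiableAt ℂ (fun z =>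
      ∏ k, (1 - zeroInv t x y k * z) / (1 - poleInv t x y k * z)) z := by
    refine DifferentiableAt.fun_finsetProd fun k _ =>
      DifferentiableAt.fun_div (by fun_prop) (by fun_prop) (sub_ne_zero.mpr fun h => ?_)
    have hzr : ‖z‖ ≤ r := by simpa [abs_of_pos hr.1] using hz
    have hlt : ‖poleInv t x y k * z‖ < 1 := by
      rw [norm_mul]
      exact (mul_le_mul_of_nonneg_left hzr (norm_nonneg _)).trans_lt (hr.2 k).2
    simp [← h] at hlt
  rw [circleAverage_of_differentiable_on_off_countable Set.countable_empty
    (fun z hz => (hdiff z hz).continuousAt.continuousWithinAt)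
    (fun z hz => hdiff z (ball_subset_closedBall hz.1))]
  simp

theorem trigonometric_limit (hq0 : q ≠ 0) (hq : ‖q‖ < 1) (ht : t ≠ 0) (ht1 : t ≠ 1)
    (hx : ∀ i, x i ≠ 0) (hy : ∀ j, y j ≠ 0) (hxi : Function.Injective x)
    (hyi : Function.Injective y) (hxy : ∀ i j, ∀ m : ℕ, x i * y j * q ^ m ≠ 1) :
    Tendsto (fun p => ellC M N t p x y) (𝓝[≠] 0) (𝓝 1) ∧
      Tendsto (fun p => functionalEquationLeft q t p x y) (𝓝[≠] 0)
        (𝓝 (trigMacdonald M q t (fun x' => trigKernel M N q t x' y) x -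
          t ^ ((M : ℤ) - (N : ℤ)) * trigMacdonald N q t (fun y' => trigKernel M N q t x y') y)) ∧
      Tendsto (fun p => functionalEquationRight q t p x y) (𝓝[≠] 0)
        (𝓝 ((1 - t ^ ((M : ℤ) - (N : ℤ))) / (1 - t) * trigKernel M N q t x y)) ∧
      trigMacdonald M q t (fun x' => trigKernel M N q t x' y) x -
          t ^ ((M : ℤ) - (N : ℤ)) * trigMacdonald N q t (fun y' => trigKernel M N q t x y') y =
        (1 - t ^ ((M : ℤ) - (N : ℤ))) / (1 - t) * trigKernel M N q t x y := by
  obtain ⟨r, hr⟩ := exists_isExpansionRadius_zero ht hx hy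
  have hxy' (i : Fin M) (j : Fin N) : qpPoch q 0 (x i * y j) ≠ 0 :=
    qpPoch_zero_right q _ ▸ qPoch_ne_zero hq (hxy i j)
  have htp := (eventually_forall_ne_zpow ht ht1).self_of_nhds
  have hp : Tendsto (fun p : ℂ => p) (𝓝[≠] 0) (𝓝 0) := nhdsWithin_le_nhds
  have hw : Tendsto (fun p : ℂ => (p, x, y)) (𝓝[≠] 0) (𝓝 (0, x, y)) :=
    hp.prodMk_nhds tendsto_const_nhds
  have hleft : functionalEquationLeft q t 0 x y =
      trigMacdonald M q t (fun x' => trigKernel M N q t x' y) x -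
        t ^ ((M : ℤ) - (N : ℤ)) * trigMacdonald N q t (fun y' => trigKernel M N q t x y') y := by
    simp only [functionalEquationLeft, ellMacdonald_zero _ _ _ hx, ellMacdonald_zero _ _ _ hy,
      ellKernel_zero]
  have hright : functionalEquationRight q t 0 x y =
      (1 - t ^ ((M : ℤ) - (N : ℤ))) / (1 - t) * trigKernel M N q t x y := by
    simp only [functionalEquationRight, ellC_zero hr, theta_zero_left, ellKernel_zero,
      qPoch_zero_left, sub_zero, one_pow, mul_one]
  have hC := (continuousAt_ellC ht hr).tendsto.comp hw
  have hL := (continuousAt_functionalEquationLeft hq0 hq ht hxi hyi hxy' hr).tendsto.comp hw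
  have hR := (continuousAt_functionalEquationRight hq ht htp hxy' hr).tendsto.comp hw
  have heq := functional_equation_zero hq0 hq ht ht1 hxi hyi hxy' hr
  simp only [Function.comp_def, ellC_zero hr] at hC
  simp only [Function.comp_def, hleft] at hL
  simp only [Function.comp_def, hright] at hR
  exact ⟨hC, hL, hR, hleft ▸ hright ▸ heq⟩

end TrigonometricLimit

section ExponentialSeries

open Finset.HasAntidiagonal

variable {σ : Type*} {h : σ → ℂ}

/-- The monomial with exponents `k` in the expansion of `exp (∑ m, h m)` into monomials in the
summands `h m`. -/
noncomputable def expTerm (h : σ → ℂ) (k : σ →₀ ℕ) : ℂ :=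
  k.prod fun m e => h m ^ e / (e.factorial : ℂ)

lemma expTerm_eq_prod (h : σ → ℂ) {k : σ →₀ ℕ} {s : Finset σ} (hs : k.support ⊆ s) :
    expTerm h k = ∏ m ∈ s, h m ^ k m / ((k m).factorial : ℂ) :=
  Finsupp.prod_of_support_subset k hs _ fun m _ => by simp

lemma mul_expTerm_erase (h : σ → ℂ) (k : σ →₀ ℕ) (m : σ) :
    h m ^ k m / ((k m).factorial : ℂ) * expTerm h (k.erase m) = expTerm h k :=
  Finsupp.mul_prod_erase' k m (fun m e => h m ^ e / (e.factorial : ℂ)) fun _ => by simp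

lemma norm_expTerm (h : σ → ℂ) (k : σ →₀ ℕ) :
    (‖expTerm h k‖ : ℂ) = expTerm (fun m => (‖h m‖ : ℂ)) k := by
  simp [expTerm, Finsupp.prod, norm_prod]

lemma expTerm_zero [DecidableEq σ] (k : σ →₀ ℕ) :
    expTerm (fun _ => 0) k = if k = 0 then 1 else 0 := by
  split_ifs with hk
  · simp [hk, expTerm]
  · obtain ⟨m, hm⟩ := Finsupp.support_nonempty_iff.mpr hk
    exact Finset.prod_eq_zero hm (by simp [Finsupp.mem_support_iff.mp hm])

lemma hasSum_expTerm_of_support_subset [DecidableEq σ] (h : σ → ℂ) (s : Finset σ) :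
    HasSum (fun k : σ →₀ ℕ => if k.support ⊆ s then expTerm h k else 0)
      (Complex.exp (∑ m ∈ s, h m)) := by
  induction s using Finset.induction_on with
  | empty =>
    simp only [Finset.subset_empty, Finsupp.support_eq_empty, Finset.sum_empty, Complex.exp_zero]
    convert! hasSum_ite_eq (0 : σ →₀ ℕ) (1 : ℂ) using 2 with k
    split_ifs with hk
    · simp [hk, expTerm]
    · rfl
  | insert m s hm ih =>
    have hexp : HasSum (fun n : ℕ => h m ^ n / (n.factorial : ℂ)) (Complex.exp (h m)) := by
      rw [Complex.exp_eq_exp_ℂ]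
      exact NormedSpace.expSeries_div_hasSum_exp (h m)
    have hsummable := summable_mul_of_summable_norm hexp.summable.norm ih.summable.norm
    have hprod := hexp.mul ih hsummable
    have hinj : Function.Injective fun k : σ →₀ ℕ => (k m, k.erase m) := fun k k' hk => by
      obtain ⟨hm, he⟩ := Prod.ext_iff.mp hk
      dsimp only at hm he
      rw [← Finsupp.single_add_erase m k, ← Finsupp.single_add_erase m k', hm, he]
    rw [Finset.sum_insert hm, Complex.exp_add]
    have hzero (nk : ℕ × (σ →₀ ℕ)) (hnk : nk ∉ Set.range fun k : σ →₀ ℕ => (k m, k.erase m)) :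
        (h m ^ nk.1 / (nk.1.factorial : ℂ) * if nk.2.support ⊆ s then expTerm h nk.2 else 0) =
          0 := by
      refine mul_eq_zero_of_right _ (if_neg fun hs => hnk ?_)
      have hnm : nk.2 m = 0 := Finsupp.notMem_support_iff.mp fun h' => hm (hs h')
      exact ⟨Finsupp.single m nk.1 + nk.2, by ext <;> simp [hnm, Finsupp.erase_add]⟩
    have hcomp := (hinj.hasSum_iff hzero).mpr hprod
    simpa only [Function.comp_def, Finsupp.support_erase, ← Finset.subset_insert_iff, mul_ite,
      mul_zero, mul_expTerm_erase] using hcomp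

lemma summable_norm_expTerm (hh : Summable fun m => ‖h m‖) :
    Summable fun k => ‖expTerm h k‖ := by
  classical
  refine summable_of_sum_le (c := Real.exp (∑' m, ‖h m‖)) (fun _ => norm_nonneg _) fun T => ?_
  set S := T.biUnion Finsupp.support
  have hsum : HasSum (fun k : σ →₀ ℕ => if k.support ⊆ S then ‖expTerm h k‖ else 0)
      (Real.exp (∑ m ∈ S, ‖h m‖)) := by
    rw [← Complex.hasSum_ofReal]
    convert! hasSum_expTerm_of_support_subset (fun m => (‖h m‖ : ℂ)) S using 2 with k
    · rw [← norm_expTerm]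
      split_ifs <;> simp
    · push_cast
      rfl
  calc ∑ k ∈ T, ‖expTerm h k‖ = ∑ k ∈ T, if k.support ⊆ S then ‖expTerm h k‖ else 0 :=
        Finset.sum_congr rfl fun k hk => (if_pos (Finset.subset_biUnion_of_mem _ hk)).symm
    _ ≤ Real.exp (∑ m ∈ S, ‖h m‖) :=
        sum_le_hasSum T (fun k _ => by split_ifs <;> positivity) hsum
    _ ≤ Real.exp (∑' m, ‖h m‖) :=
        Real.exp_le_exp.mpr (hh.sum_le_tsum S fun _ _ => norm_nonneg _)

lemma hasSum_expTerm (hh : Summable fun m => ‖h m‖) :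
    HasSum (expTerm h) (Complex.exp (∑' m, h m)) := by
  classical
  have hs := summable_norm_expTerm hh
  have hlim : Tendsto (fun S : Finset σ => ∑' k : σ →₀ ℕ,
      if k.support ⊆ S then expTerm h k else 0) atTop (𝓝 (∑' k, expTerm h k)) := by
    refine tendsto_tsum_of_dominated_convergence hs (fun k => ?_) (.of_forall fun S k => ?_)
    · refine tendsto_const_nhds.congr' ?_
      filter_upwards [eventually_ge_atTop k.support] with S hS
      exact (if_pos hS).symm
    · split_ifs <;> simp
  simp only [(hasSum_expTerm_of_support_subset h _).tsum_eq] at hlim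
  rw [← tendsto_nhds_unique hlim ((Complex.continuous_exp.tendsto _).comp hh.of_norm.hasSum)]
  exact hs.of_norm.hasSum

lemma add_pow_div_factorial (a b : ℂ) (n : ℕ) :
    (a + b) ^ n / (n.factorial : ℂ) = ∑ ij ∈ antidiagonal n,
      a ^ ij.1 / (ij.1.factorial : ℂ) * (b ^ ij.2 / (ij.2.factorial : ℂ)) := by
  rw [(Commute.all a b).add_pow', Finset.sum_div]
  refine Finset.sum_congr rfl fun ij hij => ?_
  have hne (k : ℕ) : (k.factorial : ℂ) ≠ 0 := Nat.cast_ne_zero.mpr k.factorial_ne_zero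
  rw [← mem_antidiagonal.mp hij, nsmul_eq_mul, div_mul_div_comm,
    div_eq_div_iff (hne _) (mul_ne_zero (hne _) (hne _))]
  have hchoose := Nat.add_choose_mul_factorial_mul_factorial ij.1 ij.2
  rw [← Nat.choose_symm_add] at hchoose
  rw [← hchoose]
  push_cast
  ring

lemma sum_antidiagonal_prod_support [DecidableEq σ] {R : Type*} [CommSemiring R]
    (f : σ → ℕ → ℕ → R) (k : σ →₀ ℕ) :
    ∑ ab ∈ antidiagonal k, ∏ m ∈ k.support, f m (ab.1 m) (ab.2 m) =
      ∏ m ∈ k.support, ∑ ij ∈ antidiagonal (k m), f m ij.1 ij.2 := by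
  rw [Finset.prod_sum]
  refine Finset.sum_bij' (fun ab _ m _ => (ab.1 m, ab.2 m))
    (fun g _ => (Finsupp.indicator k.support fun m hm => (g m hm).1,
      Finsupp.indicator k.support fun m hm => (g m hm).2))
    (fun ab hab => ?_) (fun g hg => ?_) (fun ab hab => ?_) (fun g _ => ?_)
    fun ab _ => (Finset.prod_attach k.support _).symm
  · simp [← mem_antidiagonal.mp hab]
  · rw [mem_antidiagonal]
    ext m
    by_cases hm : m ∈ k.support
    · simp [Finsupp.indicator_apply, hm, mem_antidiagonal.mp (Finset.mem_pi.mp hg m hm)]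
    · simp [Finsupp.indicator_apply, hm, Finsupp.notMem_support_iff.mp hm]
  · have hzero (m) (hm : m ∉ k.support) : ab.1 m = 0 ∧ ab.2 m = 0 := by
      rw [Finsupp.notMem_support_iff, ← mem_antidiagonal.mp hab, Finsupp.add_apply] at hm
      lia
    ext m <;> by_cases hm : m ∈ k.support <;> simp [Finsupp.indicator_apply, hm, hzero]
  · ext m hm <;> simp [Finsupp.indicator_apply, hm]

lemma expTerm_add [DecidableEq σ] (h h' : σ → ℂ) (k : σ →₀ ℕ) :
    expTerm (fun m => h m + h' m) k =
      ∑ ab ∈ antidiagonal k, expTerm h ab.1 * expTerm h' ab.2 := by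
  rw [expTerm_eq_prod _ subset_rfl]
  simp only [add_pow_div_factorial]
  rw [← sum_antidiagonal_prod_support fun m i j =>
    h m ^ i / (i.factorial : ℂ) * (h' m ^ j / (j.factorial : ℂ))]
  refine Finset.sum_congr rfl fun ab hab => ?_
  have hab := mem_antidiagonal.mp hab
  rw [expTerm_eq_prod h (Finsupp.support_mono (hab ▸ le_self_add)),
    expTerm_eq_prod h' (Finsupp.support_mono (hab ▸ le_add_self)), Finset.prod_mul_distrib]

lemma coeff_expSeries (d : Mode → ℂ) (k : Mode →₀ ℕ) :
    MvPowerSeries.coeff k (expSeries d) = expTerm d k := by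
  change (k.prod fun m e => ((e.factorial : ℂ)⁻¹) • d m ^ e) = _
  simp only [expTerm, smul_eq_mul, div_eq_inv_mul]

lemma coeff_prod_expSeries {κ : Type*} (s : Finset κ) (d : κ → Mode → ℂ) (k : Mode →₀ ℕ) :
    MvPowerSeries.coeff k (∏ i ∈ s, expSeries (d i)) = expTerm (fun m => ∑ i ∈ s, d i m) k := by
  classical
  induction s using Finset.induction_on generalizing k with
  | empty => simp only [Finset.prod_empty, Finset.sum_empty, expTerm_zero, MvPowerSeries.coeff_one]
  | insert i s hi ih =>
    simp only [Finset.prod_insert hi, MvPowerSeries.coeff_mul, Finset.sum_insert hi, ih,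
      coeff_expSeries, expTerm_add]

end ExponentialSeries

section VacuumExpectation

variable {q t p : ℂ}

lemma creationMonomial_apply (k : Mode →₀ ℕ) (f : Fock) :
    creationMonomial k f = MvPolynomial.monomial k 1 * f := by
  classical
  have hprod (s : Finset Mode) (hs) : s.noncommProd (fun m => creation m ^ k m) hs f =
      (∏ m ∈ s, MvPolynomial.X m ^ k m) * f := by
    induction s using Finset.induction_on with
    | empty => simp
    | insert m s hm ih =>
      rw [Finset.noncommProd_insert_of_notMem _ _ _ _ hm, Module.End.mul_apply, ih,
        Finset.prod_insert hm, creation, LinearMap.pow_mulLeft, LinearMap.mulLeft_apply, mul_assoc]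
  rw [MvPolynomial.monomial_eq, map_one, one_mul]
  exact hprod k.support _

lemma annihilation_pow_monomial (m : Mode) (n : ℕ) (e : Mode →₀ ℕ) (c : ℂ) :
    (annihilation q t p m ^ n) (MvPolynomial.monomial e c) =
      MvPolynomial.monomial (e - Finsupp.single m n)
        (c * (bosonNorm q t p m ^ n * ((e m).descFactorial n : ℂ))) := by
  induction n with
  | zero => simp
  | succ n ih =>
    rw [pow_succ', Module.End.mul_apply, ih, annihilation, LinearMap.smul_apply,
      Derivation.coeFn_coe, MvPolynomial.pderiv_monomial, MvPolynomial.smul_monomial,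
      tsub_tsub, ← Finsupp.single_add, Nat.descFactorial_succ, Finsupp.tsub_apply,
      Finsupp.single_eq_same, smul_eq_mul]
    congr 1
    push_cast
    ring

/-- The scalar with which the annihilation monomial with exponents `k` sends the Fock vector with
exponents `e` to the one with exponents `e - k`; it vanishes unless `k ≤ e`. -/
noncomputable def contraction (q t p : ℂ) (k e : Mode →₀ ℕ) : ℂ :=
  k.prod fun m n => bosonNorm q t p m ^ n * ((e m).descFactorial n : ℂ)

lemma contraction_eq_prod {k : Mode →₀ ℕ} (e : Mode →₀ ℕ) {s : Finset Mode}
    (hs : k.support ⊆ s) :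
    contraction q t p k e =
      ∏ m ∈ s, bosonNorm q t p m ^ k m * ((e m).descFactorial (k m) : ℂ) :=
  Finsupp.prod_of_support_subset k hs _ fun m _ => by simp

lemma contraction_eq_zero {k e : Mode →₀ ℕ} (h : ¬ k ≤ e) : contraction q t p k e = 0 := by
  obtain ⟨m, hm⟩ := not_forall.mp h
  rw [not_le] at hm
  refine Finset.prod_eq_zero (i := m) (Finsupp.mem_support_iff.mpr (by lia)) ?_
  simp only [Nat.descFactorial_eq_zero_iff_lt.mpr hm, Nat.cast_zero, mul_zero]

lemma annihilationMonomial_monomial (k e : Mode →₀ ℕ) (c : ℂ) :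
    annihilationMonomial q t p k (MvPolynomial.monomial e c) =
      MvPolynomial.monomial (e - k) (c * contraction q t p k e) := by
  classical
  have hprod (s : Finset Mode) (hs) :
      s.noncommProd (fun m => annihilation q t p m ^ k m) hs (MvPolynomial.monomial e c) =
      MvPolynomial.monomial (e - ∑ m ∈ s, Finsupp.single m (k m))
        (c * ∏ m ∈ s, (bosonNorm q t p m ^ k m * ((e m).descFactorial (k m) : ℂ))) := by
    induction s using Finset.induction_on with
    | empty => simp
    | insert m s hm ih =>
      have happly : (e - ∑ m ∈ s, Finsupp.single m (k m)) m = e m := by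
        rw [Finsupp.tsub_apply, Finsupp.finsetSum_apply, Finset.sum_eq_zero, tsub_zero]
        exact fun i hi => Finsupp.single_eq_of_ne fun h => hm (h ▸ hi)
      rw [Finset.noncommProd_insert_of_notMem _ _ _ _ hm, Module.End.mul_apply, ih,
        annihilation_pow_monomial, happly, tsub_tsub, Finset.sum_insert hm, Finset.prod_insert hm,
        add_comm (Finsupp.single m (k m)), mul_assoc, mul_comm (∏ m ∈ s, _)]
  exact (hprod k.support _).trans (congrArg (fun e' => MvPolynomial.monomial (e - e') _)
    (Finsupp.sum_single k))

lemma vev_monomials (k₁ k₂ k₃ k₄ : Mode →₀ ℕ) :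
    vev (annihilationMonomial q t p k₁ * creationMonomial k₂ *
        annihilationMonomial q t p k₃ * creationMonomial k₄) =
      if k₂ + (k₄ - k₃) - k₁ = 0 then
        contraction q t p k₃ k₄ * contraction q t p k₁ (k₂ + (k₄ - k₃))
      else 0 := by
  classical
  rw [vev, Module.End.mul_apply, Module.End.mul_apply, Module.End.mul_apply,
    creationMonomial_apply k₄, mul_one, annihilationMonomial_monomial, creationMonomial_apply,
    MvPolynomial.monomial_mul, annihilationMonomial_monomial,
    MvPolynomial.constantCoeff_monomial, one_mul, one_mul]

lemma vev_monomials_eq_zero {k₁ k₂ k₃ k₄ : Mode →₀ ℕ}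
    (h : ¬ (k₃ ≤ k₄ ∧ k₁ = k₂ + (k₄ - k₃))) :
    vev (annihilationMonomial q t p k₁ * creationMonomial k₂ *
        annihilationMonomial q t p k₃ * creationMonomial k₄) = 0 := by
  rw [vev_monomials]
  refine ite_eq_right_iff.mpr fun hsub => ?_
  by_cases hle : k₃ ≤ k₄
  · rw [contraction_eq_zero fun h' => h ⟨hle, le_antisymm h' (tsub_eq_zero_iff_le.mp hsub)⟩,
      mul_zero]
  · rw [contraction_eq_zero hle, zero_mul]

lemma cast_descFactorial_add (b c : ℕ) :
    ((b + c).descFactorial b : ℂ) = ((b + c).factorial : ℂ) / (c.factorial : ℂ) := by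
  have hfact := Nat.factorial_mul_descFactorial (Nat.le_add_right b c)
  rw [Nat.add_sub_cancel_left] at hfact
  rw [eq_div_iff (Nat.cast_ne_zero.mpr c.factorial_ne_zero), ← hfact, Nat.cast_mul, mul_comm]

-- Wick's theorem: in a nonvanishing term, `a`, `b` and `c` count the contractions of the second,
-- third and first factor with the first, fourth and fourth one.
lemma expTerm_mul_vev (α β γ δ : Mode → ℂ) (a b c : Mode →₀ ℕ) :
    expTerm α (a + c) * (expTerm β a * expTerm γ b) * expTerm δ (b + c) *
      vev (annihilationMonomial q t p (a + c) * creationMonomial a *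
        annihilationMonomial q t p b * creationMonomial (b + c)) =
      expTerm (fun m => bosonNorm q t p m * α m * β m) a *
        expTerm (fun m => bosonNorm q t p m * δ m * γ m) b *
        expTerm (fun m => bosonNorm q t p m * α m * δ m) c := by
  classical
  rw [vev_monomials, add_tsub_cancel_left, if_pos (tsub_self _)]
  set S := a.support ∪ b.support ∪ c.support
  have ha : a.support ⊆ S := Finset.subset_union_left.trans Finset.subset_union_left
  have hb : b.support ⊆ S := Finset.subset_union_right.trans Finset.subset_union_left
  have hc : c.support ⊆ S := Finset.subset_union_right
  have hac : (a + c).support ⊆ S := Finsupp.support_add.trans (Finset.union_subset ha hc)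
  have hbc : (b + c).support ⊆ S := Finsupp.support_add.trans (Finset.union_subset hb hc)
  rw [expTerm_eq_prod _ ha, expTerm_eq_prod _ ha, expTerm_eq_prod _ hb, expTerm_eq_prod _ hb,
    expTerm_eq_prod _ hc, expTerm_eq_prod _ hac, expTerm_eq_prod _ hbc,
    contraction_eq_prod _ hb, contraction_eq_prod _ hac]
  simp only [← Finset.prod_mul_distrib]
  refine Finset.prod_congr rfl fun m _ => ?_
  simp only [Finsupp.add_apply, Nat.descFactorial_self, cast_descFactorial_add]
  have hne (n : ℕ) : (n.factorial : ℂ) ≠ 0 := Nat.cast_ne_zero.mpr n.factorial_ne_zero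
  field_simp [hne (c m), hne (a m + c m), hne (b m + c m)]
  ring

end VacuumExpectation

section LaurentDegree

open LaurentPolynomial

lemma prod_smul_C_mul_T_pow {ι : Type*} (s : Finset ι) (c : ι → ℂ) (d : ι → ℤ) (k : ι → ℕ) :
    ∏ m ∈ s, ((k m).factorial : ℂ)⁻¹ • (C (c m) * T (d m)) ^ k m =
      C (∏ m ∈ s, c m ^ k m / ((k m).factorial : ℂ)) * T (∑ m ∈ s, (k m : ℤ) * d m) := by
  classical
  induction s using Finset.induction_on with
  | empty => simp
  | insert m s hm ih =>
    rw [Finset.prod_insert hm, Finset.prod_insert hm, Finset.sum_insert hm, ih,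
      smul_eq_C_mul, mul_pow, ← map_pow, T_pow, T_add, map_mul, div_eq_inv_mul, map_mul]
    ring

lemma coeff_expSeries_C_mul_T (c : Mode → ℂ) (d : Mode → ℤ) (k : Mode →₀ ℕ) :
    MvPowerSeries.coeff k (expSeries fun m => (C (c m) * T (d m) : ℂ[T;T⁻¹])) =
      C (expTerm c k) * T (k.sum fun m e => e * d m) :=
  prod_smul_C_mul_T_pow k.support c d k

lemma coeff_zero_C_mul_T_mul (a b : ℂ) (m n : ℤ) :
    ((C a * T m) * (C b * T n) : ℂ[T;T⁻¹]).coeff 0 = if m + n = 0 then a * b else 0 := by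
  rw [mul_mul_mul_comm, ← map_mul, ← T_add, ← single_eq_C_mul_T, AddMonoidAlgebra.coeff_single,
    Finsupp.single_apply]

end LaurentDegree

section FreeFieldPairings

/-- A logarithm of `(p; p)_∞ / Θ_p(u)` on the annulus `|p| < |u| < 1`. -/
noncomputable def invThetaLog (p u : ℂ) : ℂ := pochLog 0 p u + pochLog 0 p (p * u⁻¹)

/-- A logarithm of `Γ_{q,p}(u)` on the annulus `|qp| < |u| < 1`. -/
noncomputable def ellGammaLog (q p u : ℂ) : ℂ := pochLog q p u - pochLog q p (q * p * u⁻¹)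

/-- The Laurent series of `invThetaLog p u` in `u`, with `Sum.inl n` and `Sum.inr n` indexing the
powers `u ^ n` and `u ^ (-n)`. -/
noncomputable def invThetaLogTerm (p u : ℂ) : Mode → ℂ
  | Sum.inl n => u ^ (n : ℕ) / (1 - p ^ (n : ℕ)) / (n : ℂ)
  | Sum.inr n => (p * u⁻¹) ^ (n : ℕ) / (1 - p ^ (n : ℕ)) / (n : ℂ)

/-- The Laurent series of `ellGammaLog q p u` in `u`, with `Sum.inl n` and `Sum.inr n` indexing
the powers `u ^ n` and `u ^ (-n)`. -/
noncomputable def ellGammaLogTerm (q p u : ℂ) : Mode → ℂ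
  | Sum.inl n => u ^ (n : ℕ) / ((1 - q ^ (n : ℕ)) * (1 - p ^ (n : ℕ))) / (n : ℂ)
  | Sum.inr n => -((q * p * u⁻¹) ^ (n : ℕ) / ((1 - q ^ (n : ℕ)) * (1 - p ^ (n : ℕ))) / (n : ℂ))

variable {q t p u v : ℂ}

lemma exp_invThetaLog (hpu : ‖p‖ < ‖u‖) (hu : ‖u‖ < 1) :
    Complex.exp (invThetaLog p u) = qPoch p p / theta p u := by
  have hp := hpu.trans hu
  have hpp := qPoch_self_ne_zero hp
  rw [invThetaLog, Complex.exp_add, exp_pochLog (by simp) hp hu,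
    exp_pochLog (by simp) hp (norm_mul_inv_lt_one hpu), ← qPoch_eq_qpPoch_zero,
    ← qPoch_eq_qpPoch_zero, theta, ← mul_inv, mul_assoc, div_mul_cancel_left₀ hpp]

lemma exp_invThetaLog_sub (hu : ‖p‖ < ‖u‖ ∧ ‖u‖ < 1) (hv : ‖p‖ < ‖v‖ ∧ ‖v‖ < 1) :
    Complex.exp (invThetaLog p u - invThetaLog p v) = theta p v / theta p u := by
  rw [Complex.exp_sub, exp_invThetaLog hu.1 hu.2, exp_invThetaLog hv.1 hv.2,
    div_div_div_cancel_left' _ _ (qPoch_self_ne_zero (hu.1.trans hu.2))]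

lemma exp_ellGammaLog (hq : ‖q‖ < 1) (hp : ‖p‖ < 1) (hqpu : ‖q * p‖ < ‖u‖) (hu : ‖u‖ < 1) :
    Complex.exp (ellGammaLog q p u) = ellGamma q p u := by
  rw [ellGammaLog, Complex.exp_sub, exp_pochLog hq hp hu,
    exp_pochLog hq hp (norm_mul_inv_lt_one hqpu), inv_div_inv, ellGamma]

lemma hasSum_invThetaLogTerm (hpu : ‖p‖ < ‖u‖) (hu : ‖u‖ < 1) :
    HasSum (invThetaLogTerm p u) (invThetaLog p u) := by
  have hpoch {w : ℂ} (hw : ‖w‖ < 1) :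
      HasSum (fun n : ℕ+ => w ^ (n : ℕ) / (1 - p ^ (n : ℕ)) / (n : ℂ)) (pochLog 0 p w) := by
    simpa using hasSum_pochLog (q := 0) (by simp) (hpu.trans hu) hw
  exact (hpoch hu).sum (hpoch (norm_mul_inv_lt_one hpu))

lemma hasSum_ellGammaLogTerm (hq : ‖q‖ < 1) (hp : ‖p‖ < 1) (hqpu : ‖q * p‖ < ‖u‖)
    (hu : ‖u‖ < 1) : HasSum (ellGammaLogTerm q p u) (ellGammaLog q p u) := by
  rw [ellGammaLog, sub_eq_add_neg]
  exact (hasSum_pochLog hq hp hu).sum (hasSum_pochLog hq hp (norm_mul_inv_lt_one hqpu)).neg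

/-- The power of `z` that accompanies the modes `a_{-n}` and `b_{-n}` in `η(p; z)`. -/
def modeDegree : Mode → ℤ
  | Sum.inl n => n
  | Sum.inr n => -n

/-- `xⁿ` for the modes `a_{±n}` and `x⁻ⁿ` for the modes `b_{±n}`. -/
noncomputable def modePow (x : ℂ) : Mode → ℂ
  | Sum.inl n => x ^ (n : ℕ)
  | Sum.inr n => (x ^ (n : ℕ))⁻¹

/-- The exponent of `(η(p; z))_-` at `z = 1`. -/
noncomputable def etaMinusConst (t p : ℂ) : Mode → ℂ
  | Sum.inl n => (1 - t⁻¹ ^ (n : ℕ)) / (1 - p ^ (n : ℕ)) / (n : ℂ)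
  | Sum.inr n => (1 - t ^ (n : ℕ)) * p ^ (n : ℕ) / (1 - p ^ (n : ℕ)) / (n : ℂ)

/-- The exponent of `(η(p; p⁻¹z))_+` at `z = 1`. -/
noncomputable def etaPlusConst (t p : ℂ) : Mode → ℂ
  | Sum.inl n => -((1 - t ^ (n : ℕ)) * p ^ (n : ℕ) / (1 - p ^ (n : ℕ)) / (n : ℂ))
  | Sum.inr n => -((1 - t⁻¹ ^ (n : ℕ)) / (1 - p ^ (n : ℕ)) / (n : ℂ))

lemma modePow_eq_zpow (z : ℂ) (m : Mode) : modePow z m = z ^ modeDegree m := by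
  rcases m with n | n
  · exact (zpow_natCast z n).symm
  · rw [modePow, modeDegree, zpow_neg]
    exact congrArg _ (zpow_natCast z n).symm

lemma etaMinusCoeff_one (t p : ℂ) (m : Mode) :
    etaMinusCoeff t p 1 m =
      LaurentPolynomial.C (etaMinusConst t p m) * LaurentPolynomial.T (modeDegree m) := by
  rcases m with n | n
  · rw [etaMinusCoeff, etaCoeffA, neg_neg, modeDegree]
    congr 2
    simp only [etaMinusConst, zpow_neg, zpow_natCast, Int.natAbs_neg, Int.natAbs_natCast,
      Int.cast_neg, Int.cast_natCast, inv_pow]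
    ring
  · rw [etaMinusCoeff, etaCoeffB, modeDegree]
    congr 2
    simp only [etaMinusConst, neg_neg, zpow_natCast, Int.natAbs_neg, Int.natAbs_natCast, one_zpow,
      Int.cast_neg, Int.cast_natCast]
    ring

lemma etaPlusCoeff_inv (t : ℂ) (hp0 : p ≠ 0) (m : Mode) :
    etaPlusCoeff t p p⁻¹ m =
      LaurentPolynomial.C (etaPlusConst t p m) * LaurentPolynomial.T (-modeDegree m) := by
  rcases m with n | n
  · rw [etaPlusCoeff, etaCoeffA, modeDegree]
    congr 2
    simp only [etaPlusConst, zpow_natCast, zpow_neg, Int.natAbs_natCast, Int.cast_natCast, inv_pow,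
      inv_inv]
    ring
  · rw [etaPlusCoeff, etaCoeffB, modeDegree, neg_neg]
    congr 2
    have hpn : p ^ (n : ℕ) ≠ 0 := pow_ne_zero _ hp0
    simp only [etaPlusConst, zpow_natCast, zpow_neg, Int.natAbs_natCast, Int.cast_natCast, inv_pow]
    field_simp

lemma bosonNorm_mul_phiCoeff (hq0 : q ≠ 0) (hq : ‖q‖ < 1) (ht : t ≠ 0)
    (ht1 : ∀ n : ℕ, 0 < n → t ^ n ≠ 1) (hp0 : p ≠ 0) (hp : ‖p‖ < 1) (x : ℂ) (m : Mode) :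
    bosonNorm q t p m * phiCoeff q t p x m = modePow x m := by
  have hn (n : ℕ+) : (n : ℂ) ≠ 0 := Nat.cast_ne_zero.mpr n.ne_zero
  have htn (n : ℕ+) : 1 - t ^ (n : ℕ) ≠ 0 := sub_ne_zero.mpr (ht1 n n.pos).symm
  have hqn := one_sub_pow_ne_zero hq
  have hpn := one_sub_pow_ne_zero hp
  rcases m with n | n <;> simp only [bosonNorm, phiCoeff, modePow]
  · field_simp [hn n, htn n, hqn n, hpn n]
  · have hqtp : (q * t⁻¹ * p) ^ (n : ℕ) ≠ 0 :=
      pow_ne_zero _ (mul_ne_zero (mul_ne_zero hq0 (inv_ne_zero ht)) hp0)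
    generalize (q * t⁻¹ * p) ^ (n : ℕ) = a at hqtp ⊢
    field_simp [hn n, htn n, hqn n, hpn n]

lemma modePow_mul_etaMinusConst (t p x z : ℂ) (m : Mode) :
    modePow x m * etaMinusConst t p m * z ^ modeDegree m =
      invThetaLogTerm p (x * z) m - invThetaLogTerm p (t⁻¹ * x * z) m := by
  rw [← modePow_eq_zpow]
  rcases m with n | n <;>
  · simp only [modePow, etaMinusConst, invThetaLogTerm, mul_pow, inv_pow, mul_inv, inv_inv]
    ring

-- The modes `a_n` of `(η(p; p⁻¹z))_+` produce the negative powers of `z`, whence the swap.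
lemma modePow_mul_etaPlusConst (t p y z : ℂ) (m : Mode) :
    modePow y m * etaPlusConst t p m * z ^ (-modeDegree m) =
      invThetaLogTerm p (t⁻¹ * y⁻¹ * z) m.swap - invThetaLogTerm p (y⁻¹ * z) m.swap := by
  rw [zpow_neg, ← modePow_eq_zpow]
  rcases m with n | n <;>
  · simp only [modePow, etaPlusConst, invThetaLogTerm, Sum.swap_inl, Sum.swap_inr, mul_pow,
      inv_pow, mul_inv, inv_inv]
    ring

lemma modePow_mul_phiCoeff (ht : t ≠ 0) (q p x y : ℂ) (m : Mode) :
    modePow x m * phiCoeff q t p y m =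
      ellGammaLogTerm q p (x * y) m - ellGammaLogTerm q p (t * x * y) m := by
  rcases m with n | n <;>
    simp only [modePow, phiCoeff, ellGammaLogTerm, mul_pow, inv_pow, mul_inv]
  · ring
  · have htn : t ^ (n : ℕ) ≠ 0 := pow_ne_zero _ ht
    field_simp
    ring

end FreeFieldPairings

section MatrixElement

/-- The power of `z` that accompanies the creation monomial with exponents `k` in `(η(p; z))_-`. -/
def monomialDegree (k : Mode →₀ ℕ) : ℤ := k.sum fun m e => e * modeDegree m

lemma sum_neg_modeDegree (k : Mode →₀ ℕ) :
    (k.sum fun m e => (e : ℤ) * -modeDegree m) = -monomialDegree k := by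
  simp only [monomialDegree, Finsupp.sum, mul_neg, Finset.sum_neg_distrib]

lemma expTerm_mul_zpow {σ : Type*} (h : σ → ℂ) (d : σ → ℤ) {z : ℂ} (hz : z ≠ 0) (k : σ →₀ ℕ) :
    expTerm (fun m => h m * z ^ d m) k = expTerm h k * z ^ (k.sum fun m e => e * d m) := by
  have hzpow : z ^ (k.sum fun m e => (e : ℤ) * d m) = ∏ m ∈ k.support, (z ^ d m) ^ k m := by
    classical
    rw [Finsupp.sum]
    induction k.support using Finset.induction_on with
    | empty => rw [Finset.sum_empty, Finset.prod_empty, zpow_zero]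
    | insert m s hm ih =>
      rw [Finset.sum_insert hm, Finset.prod_insert hm, zpow_add₀ hz, ih,
        mul_comm (k m : ℤ), zpow_mul, zpow_natCast]
  rw [hzpow, expTerm, expTerm, Finsupp.prod, Finsupp.prod, ← Finset.prod_mul_distrib]
  refine Finset.prod_congr rfl fun m _ => ?_
  rw [mul_pow, div_mul_eq_mul_div]

lemma hasSum_expTerm_of_hasSum {σ : Type*} {h : σ → ℂ} {s : ℂ} (hh : HasSum h s) :
    HasSum (expTerm h) (Complex.exp s) :=
  hh.tsum_eq ▸ hasSum_expTerm hh.summable.norm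

/-- The exponents in the four factors of the matrix element for which `k.1.1`, `k.1.2` and `k.2`
are the exponents contracted between the first and second, the third and fourth, and the first
and fourth factor, respectively. -/
noncomputable def wickIndex (k : ((Mode →₀ ℕ) × (Mode →₀ ℕ)) × (Mode →₀ ℕ)) :
    (Mode →₀ ℕ) × (Mode →₀ ℕ) × (Mode →₀ ℕ) × (Mode →₀ ℕ) :=
  (k.1.1 + k.2, k.1.1, k.1.2, k.1.2 + k.2)

lemma wickIndex_injective : Function.Injective wickIndex := by
  rintro ⟨⟨a, b⟩, c⟩ ⟨⟨a', b'⟩, c'⟩ h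
  simp only [wickIndex, Prod.mk.injEq] at h
  obtain ⟨hac, rfl, rfl, -⟩ := h
  rw [add_left_cancel hac]

variable {M N : ℕ} {q t p z : ℂ} {x : Fin M → ℂ} {y : Fin N → ℂ} {r : ℝ}

lemma matrixElementTerm_eq_zero {k} (hk : k ∉ Set.range wickIndex) :
    matrixElementTerm M N q t p x y k = 0 := by
  rw [matrixElementTerm, vev_monomials_eq_zero, mul_zero]
  rintro ⟨hle, heq⟩
  refine hk ⟨((k.2.1, k.2.2.1), k.2.2.2 - k.2.2.1), ?_⟩
  simp only [wickIndex, ← heq, add_tsub_cancel_of_le hle]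

lemma matrixElementTerm_wickIndex (hp0 : p ≠ 0)
    (k : ((Mode →₀ ℕ) × (Mode →₀ ℕ)) × (Mode →₀ ℕ)) :
    matrixElementTerm M N q t p x y (wickIndex k) =
      (if monomialDegree k.1.1 - monomialDegree k.1.2 = 0 then
        expTerm (fun m => bosonNorm q t p m * (∑ i, phiCoeff q t p (x i) m) *
          etaMinusConst t p m) k.1.1 *
        expTerm (fun m => bosonNorm q t p m * (∑ j, phiCoeff q t p (y j) m) *
          etaPlusConst t p m) k.1.2 else 0) *
      expTerm (fun m => bosonNorm q t p m * (∑ i, phiCoeff q t p (x i) m) *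
        ∑ j, phiCoeff q t p (y j) m) k.2 := by
  obtain ⟨⟨a, b⟩, c⟩ := k
  simp only [matrixElementTerm, wickIndex]
  rw [coeff_prod_expSeries, coeff_prod_expSeries, funext (etaMinusCoeff_one t p),
    funext (etaPlusCoeff_inv t hp0), coeff_expSeries_C_mul_T, coeff_expSeries_C_mul_T,
    coeff_zero_C_mul_T_mul, sum_neg_modeDegree, ← monomialDegree, ← sub_eq_add_neg]
  split_ifs
  · exact expTerm_mul_vev _ _ _ _ a b c
  · simp only [mul_zero, zero_mul]

lemma hasSum_expTerm_etaMinus (hz : z ≠ 0) (hpole : ∀ i, ‖p‖ < ‖x i * z‖ ∧ ‖x i * z‖ < 1)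
    (hzero : ∀ i, ‖p‖ < ‖t⁻¹ * x i * z‖ ∧ ‖t⁻¹ * x i * z‖ < 1) :
    HasSum (fun k => expTerm (fun m => (∑ i, modePow (x i) m) * etaMinusConst t p m) k *
        z ^ monomialDegree k)
      (∏ i, theta p (t⁻¹ * x i * z) / theta p (x i * z)) := by
  have hlog (i : Fin M) :
      HasSum (fun m => modePow (x i) m * etaMinusConst t p m * z ^ modeDegree m)
        (invThetaLog p (x i * z) - invThetaLog p (t⁻¹ * x i * z)) := by
    simp only [modePow_mul_etaMinusConst]
    exact (hasSum_invThetaLogTerm (hpole i).1 (hpole i).2).sub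
      (hasSum_invThetaLogTerm (hzero i).1 (hzero i).2)
  have hexp := hasSum_expTerm_of_hasSum (hasSum_sum fun i (_ : i ∈ Finset.univ) => hlog i)
  simp only [Complex.exp_sum, exp_invThetaLog_sub (hpole _) (hzero _), ← Finset.sum_mul] at hexp
  exact hexp.congr_fun fun k => (expTerm_mul_zpow _ _ hz k).symm

lemma hasSum_expTerm_etaPlus (hz : z ≠ 0)
    (hpole : ∀ j, ‖p‖ < ‖t⁻¹ * (y j)⁻¹ * z‖ ∧ ‖t⁻¹ * (y j)⁻¹ * z‖ < 1)
    (hzero : ∀ j, ‖p‖ < ‖(y j)⁻¹ * z‖ ∧ ‖(y j)⁻¹ * z‖ < 1) :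
    HasSum (fun k => expTerm (fun m => (∑ j, modePow (y j) m) * etaPlusConst t p m) k *
        z ^ (-monomialDegree k))
      (∏ j, theta p ((y j)⁻¹ * z) / theta p (t⁻¹ * (y j)⁻¹ * z)) := by
  have hlog (j : Fin N) :
      HasSum (fun m => modePow (y j) m * etaPlusConst t p m * z ^ (-modeDegree m))
        (invThetaLog p (t⁻¹ * (y j)⁻¹ * z) - invThetaLog p ((y j)⁻¹ * z)) := by
    simp only [modePow_mul_etaPlusConst]
    exact (Equiv.sumComm ℕ+ ℕ+).hasSum_iff.mpr
      ((hasSum_invThetaLogTerm (hpole j).1 (hpole j).2).sub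
        (hasSum_invThetaLogTerm (hzero j).1 (hzero j).2))
  have hexp := hasSum_expTerm_of_hasSum (hasSum_sum fun j (_ : j ∈ Finset.univ) => hlog j)
  simp only [Complex.exp_sum, exp_invThetaLog_sub (hpole _) (hzero _), ← Finset.sum_mul] at hexp
  refine hexp.congr_fun fun k => ?_
  rw [← sum_neg_modeDegree, ← expTerm_mul_zpow _ _ hz]

lemma hasSum_expTerm_thetaRatio (hr : IsExpansionRadius t p x y r)
    (hzero : ∀ k, ‖p‖ < ‖zeroInv t x y k‖ * r ∧ ‖zeroInv t x y k‖ * r < 1)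
    (hz : z ∈ Metric.sphere (0 : ℂ) r) :
    HasSum (fun k : (Mode →₀ ℕ) × (Mode →₀ ℕ) =>
      expTerm (fun m => (∑ i, modePow (x i) m) * etaMinusConst t p m) k.1 *
        expTerm (fun m => (∑ j, modePow (y j) m) * etaPlusConst t p m) k.2 *
        z ^ (monomialDegree k.1 - monomialDegree k.2))
      (thetaRatio M N t p x y z) := by
  have hz0 : z ≠ 0 := Metric.ne_of_mem_sphere hz hr.1.ne'
  have hpole := hr.2
  simp only [← mem_sphere_zero_iff_norm.mp hz, ← norm_mul] at hpole hzero
  have hminus := hasSum_expTerm_etaMinus (x := x) hz0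
    (fun i => hpole (.inl i)) fun i => hzero (.inl i)
  have hplus := hasSum_expTerm_etaPlus (y := y) hz0
    (fun j => hpole (.inr j)) fun j => hzero (.inr j)
  have hsummable := summable_mul_of_summable_norm hminus.summable.norm hplus.summable.norm
  simp only [thetaRatio_eq_prod, Fintype.prod_sum_type]
  refine (hminus.mul hplus hsummable).congr_fun fun k => ?_
  rw [sub_eq_add_neg, zpow_add₀ hz0]
  ring

lemma ellKernel_eq_exp (hq : ‖q‖ < 1) (hp : ‖p‖ < 1)
    (hxy : ∀ i j, ‖x i * y j‖ < 1 ∧ ‖t * x i * y j‖ < 1 ∧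
      ‖q * p‖ < ‖x i * y j‖ ∧ ‖q * p‖ < ‖t * x i * y j‖) :
    ellKernel M N q t p x y =
      Complex.exp (∑ i, ∑ j, (ellGammaLog q p (x i * y j) - ellGammaLog q p (t * x i * y j))) := by
  simp only [Complex.exp_sum, Complex.exp_sub, ellKernel]
  refine Finset.prod_congr rfl fun i _ => Finset.prod_congr rfl fun j _ => ?_
  obtain ⟨hlt, htlt, hqp, htqp⟩ := hxy i j
  rw [exp_ellGammaLog hq hp hqp hlt, exp_ellGammaLog hq hp htqp htlt]

lemma hasSum_expTerm_ellKernel (hq : ‖q‖ < 1) (hp : ‖p‖ < 1) (ht : t ≠ 0)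
    (hxy : ∀ i j, ‖x i * y j‖ < 1 ∧ ‖t * x i * y j‖ < 1 ∧
      ‖q * p‖ < ‖x i * y j‖ ∧ ‖q * p‖ < ‖t * x i * y j‖) :
    HasSum (expTerm fun m => (∑ i, modePow (x i) m) * ∑ j, phiCoeff q t p (y j) m)
      (ellKernel M N q t p x y) := by
  have hlog (i : Fin M) (j : Fin N) : HasSum (fun m => modePow (x i) m * phiCoeff q t p (y j) m)
      (ellGammaLog q p (x i * y j) - ellGammaLog q p (t * x i * y j)) := by
    obtain ⟨hlt, htlt, hqp, htqp⟩ := hxy i j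
    simp only [modePow_mul_phiCoeff ht]
    exact (hasSum_ellGammaLogTerm hq hp hqp hlt).sub (hasSum_ellGammaLogTerm hq hp htqp htlt)
  simp only [ellKernel_eq_exp hq hp hxy, Finset.sum_mul_sum]
  exact hasSum_expTerm_of_hasSum (hasSum_sum fun i _ => hasSum_sum fun j _ => hlog i j)

lemma norm_inv_mul_bounds {a : ℂ} (ha : a ≠ 0) (hap : ‖a * p‖ < r) (har : r < ‖a‖) :
    ‖p‖ < ‖a⁻¹‖ * r ∧ ‖a⁻¹‖ * r < 1 := by
  have hpos := norm_pos_iff.mpr ha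
  rw [norm_inv, lt_inv_mul_iff₀ hpos, inv_mul_lt_one₀ hpos, ← norm_mul]
  exact ⟨hap, har⟩

lemma FreeFieldRegion.exists_radius (ht : t ≠ 0) (h : FreeFieldRegion M N q t p x y) :
    ∃ r, IsExpansionRadius t p x y r ∧
      ∀ k, ‖p‖ < ‖zeroInv t x y k‖ * r ∧ ‖zeroInv t x y k‖ * r < 1 := by
  obtain ⟨-, r, hr, hx, hy⟩ := h
  have hy0 (j : Fin N) : y j ≠ 0 := norm_pos_iff.mp (hr.trans (hy j).2.2.1)
  refine ⟨r, ⟨hr, Sum.forall.mpr ⟨fun i => ⟨(hx i).2.2.1, (hx i).1⟩, fun j => ?_⟩⟩,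
    Sum.forall.mpr ⟨fun i => ⟨?_, (hx i).2.1⟩, fun j => ?_⟩⟩
  · simp only [poleInv, Sum.elim_inr, ← mul_inv]
    exact norm_inv_mul_bounds (mul_ne_zero ht (hy0 j)) (mul_right_comm t p (y j) ▸ (hy j).2.1)
      (hy j).2.2.2
  · rw [zeroInv, Sum.elim_inl, norm_mul, norm_inv, mul_assoc,
      lt_inv_mul_iff₀ (norm_pos_iff.mpr ht), ← norm_mul]
    exact (hx i).2.2.2
  · exact norm_inv_mul_bounds (hy0 j) (mul_comm p (y j) ▸ (hy j).1) (hy j).2.2.1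

variable [Nonempty (Fin M ⊕ Fin N)]

lemma hasSum_expTerm_ellC (hr : IsExpansionRadius t p x y r)
    (hzero : ∀ k, ‖p‖ < ‖zeroInv t x y k‖ * r ∧ ‖zeroInv t x y k‖ * r < 1) :
    HasSum (fun k : (Mode →₀ ℕ) × (Mode →₀ ℕ) =>
      if monomialDegree k.1 - monomialDegree k.2 = 0 then
        expTerm (fun m => (∑ i, modePow (x i) m) * etaMinusConst t p m) k.1 *
          expTerm (fun m => (∑ j, modePow (y j) m) * etaPlusConst t p m) k.2
      else 0)
      (ellC M N t p x y) := by
  rw [ellC_eq_circleAverage hr]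
  exact hasSum_circleAverage_monomials hr.1 fun z hz => hasSum_expTerm_thetaRatio hr hzero hz

lemma hasSum_matrixElementTerm (hq0 : q ≠ 0) (hq : ‖q‖ < 1) (ht : t ≠ 0)
    (ht1 : ∀ n : ℕ, 0 < n → t ^ n ≠ 1) (hp0 : p ≠ 0) (hp : ‖p‖ < 1)
    (h : FreeFieldRegion M N q t p x y) :
    HasSum (matrixElementTerm M N q t p x y) (ellC M N t p x y * ellKernel M N q t p x y) := by
  obtain ⟨r, hr, hzero⟩ := h.exists_radius ht
  have hC := hasSum_expTerm_ellC hr hzero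
  have hkernel := hasSum_expTerm_ellKernel hq hp ht h.1
  have hsummable := summable_mul_of_summable_norm hC.summable.norm hkernel.summable.norm
  have hnorm {n : ℕ} (w : Fin n → ℂ) (m : Mode) :
      bosonNorm q t p m * ∑ i, phiCoeff q t p (w i) m = ∑ i, modePow (w i) m := by
    simp only [Finset.mul_sum, bosonNorm_mul_phiCoeff hq0 hq ht ht1 hp0 hp]
  refine (wickIndex_injective.hasSum_iff fun _ => matrixElementTerm_eq_zero).mp
    ((hC.mul hkernel hsummable).congr_fun fun k => ?_)
  simp only [Function.comp_apply, matrixElementTerm_wickIndex hp0, hnorm]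

lemma ellC_eq_matrixElement_div_ellKernel (hq0 : q ≠ 0) (hq : ‖q‖ < 1) (ht : t ≠ 0)
    (ht1 : ∀ n : ℕ, 0 < n → t ^ n ≠ 1) (hp0 : p ≠ 0) (hp : ‖p‖ < 1)
    (h : FreeFieldRegion M N q t p x y) :
    Summable (matrixElementTerm M N q t p x y) ∧ ellKernel M N q t p x y ≠ 0 ∧
      ellC M N t p x y = matrixElement M N q t p x y / ellKernel M N q t p x y := by
  have hsum := hasSum_matrixElementTerm hq0 hq ht ht1 hp0 hp h
  have hne : ellKernel M N q t p x y ≠ 0 := ellKernel_eq_exp hq hp h.1 ▸ Complex.exp_ne_zero _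
  exact ⟨hsum.summable, hne, by rw [matrixElement, hsum.tsum_eq, mul_div_cancel_right₀ _ hne]⟩

end MatrixElement

end EllipticKernel

theorem theorem3p2 (M N : ℕ) (hM : 0 < M) (hN : 0 < N) (q t : ℂ) (hq : q ≠ 0) (hq1 : ‖q‖ < 1)
    (ht : t ≠ 0) :
    -- the functional equation
    (∀ (p : ℂ) (x : Fin M → ℂ) (y : Fin N → ℂ), ‖p‖ < 1 → (∀ k : ℤ, t ≠ p ^ k) →
      (∀ i, x i ≠ 0) → (∀ j, y j ≠ 0) → Function.Injective x → Function.Injective y →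
      (∀ i j, ∀ m n : ℕ, x i * y j * q ^ m * p ^ n ≠ 1) →
      (expansionDomain M N t p x y).Nonempty →
      (∃ a, HasLaurentExpansionOn (thetaRatio M N t p x y) (expansionDomain M N t p x y) a) ∧
      ellMacdonald M q t p (fun x' => ellKernel M N q t p x' y) x -
          t ^ ((M : ℤ) - (N : ℤ)) * ellMacdonald N q t p (fun y' => ellKernel M N q t p x y') y =
        (1 - t ^ ((M : ℤ) - (N : ℤ))) * qPoch p p ^ 3 / theta p t *
          ellC M N t p x y * ellKernel M N q t p x y) ∧
    -- the two expressions for `C_{MN}` agree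
    (∀ (p : ℂ) (x : Fin M → ℂ) (y : Fin N → ℂ), p ≠ 0 → ‖p‖ < 1 → (∀ n : ℕ, 0 < n → t ^ n ≠ 1) →
      FreeFieldRegion M N q t p x y →
      Summable (matrixElementTerm M N q t p x y) ∧ ellKernel M N q t p x y ≠ 0 ∧
      ellC M N t p x y = matrixElement M N q t p x y / ellKernel M N q t p x y) ∧
    -- the limit `p → 0`
    (∀ (x : Fin M → ℂ) (y : Fin N → ℂ), t ≠ 1 →
      (∀ i, x i ≠ 0) → (∀ j, y j ≠ 0) → Function.Injective x → Function.Injective y →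
      (∀ i j, ∀ m : ℕ, x i * y j * q ^ m ≠ 1) →
      Tendsto (fun p => ellC M N t p x y) (𝓝[≠] 0) (𝓝 1) ∧
      Tendsto (fun p => ellMacdonald M q t p (fun x' => ellKernel M N q t p x' y) x -
          t ^ ((M : ℤ) - (N : ℤ)) * ellMacdonald N q t p (fun y' => ellKernel M N q t p x y') y)
        (𝓝[≠] 0)
        (𝓝 (trigMacdonald M q t (fun x' => trigKernel M N q t x' y) x -
          t ^ ((M : ℤ) - (N : ℤ)) * trigMacdonald N q t (fun y' => trigKernel M N q t x y') y)) ∧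
      Tendsto (fun p => (1 - t ^ ((M : ℤ) - (N : ℤ))) * qPoch p p ^ 3 / theta p t *
          ellC M N t p x y * ellKernel M N q t p x y)
        (𝓝[≠] 0)
        (𝓝 ((1 - t ^ ((M : ℤ) - (N : ℤ))) / (1 - t) * trigKernel M N q t x y)) ∧
      trigMacdonald M q t (fun x' => trigKernel M N q t x' y) x -
          t ^ ((M : ℤ) - (N : ℤ)) * trigMacdonald N q t (fun y' => trigKernel M N q t x y') y =
        (1 - t ^ ((M : ℤ) - (N : ℤ))) / (1 - t) * trigKernel M N q t x y) := by
  have : Nonempty (Fin M ⊕ Fin N) := ⟨.inl ⟨0, hM⟩⟩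
  refine ⟨fun p x y hp htp _ _ hxi hyi hxy hne => ?_, fun p x y hp0 hp ht1 h => ?_,
    fun x y ht1 hx hy hxi hyi hxy => ?_⟩
  · exact ⟨exists_hasLaurentExpansionOn_thetaRatio hp t x y,
      functional_equation hq hq1 ht hp htp hxi hyi hxy hne⟩
  · exact ellC_eq_matrixElement_div_ellKernel hq hq1 ht ht1 hp0 hp h
  · exact trigonometric_limit hq hq1 ht ht1 hx hy hxi hyi hxy
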